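/- Let $(a_n)_{n\ge 0}$ be a sequence of non-negative numbers with infinitely many non-zero terms, such that the power series $G(z)=\sum_{n\ge 0}a_n^2z^n$ has infinite radius of convergence. Let $\xi_0,\xi_1,\dots$ be independent standard complex Gaussian random variables (with density $\frac1\pi e^{-|z|^2}$ on $\mathbb C$), and let $f(z)=\sum_{n\ge 0}\xi_na_nz^n$, which is almost surely an entire function (a Gaussian entire function with transcendental covariance function $G$). For $r>0$ let $n_f(r)$ be the number of zeros of $f$ in $\{|z|\le r\}$, counted with multiplicity, and put $$a(r)=\frac{r\,G'(r)}{G(r)},\qquad b(r)=r\,a'(r)\qquad(r>0).$$ For functions $g_1,g_2\ge 0$ write $g_1(r)\gtrsim_L g_2(r)$ if there are a constant $C>0$ and a set $E\subset(0,\infty)$ of finite logarithmic measure, $\int_E \frac{dt}{t}<\infty$, such that $g_2(r)\le C\,g_1(r)$ for all $r\ge 1$, $r\notin E$. **Theorem.** The random variable $n_f(r)$ is square integrable for every $r>0$, and for every $\varepsilon>0$ $$\operatorname{Var}\bigl(n_f(r)\bigr)\gtrsim_L\frac{b(r^2)^2}{a(r^2)^{\frac32+\varepsilon}}.$$ If,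 in addition, $b$ is non-decreasing on $(0,\infty)$, then $$\operatorname{Var}\bigl(n_f(r)\bigr)\gtrsim_L\sqrt{b(r^2)}.$$ -/

import Mathlib

open MeasureTheory ProbabilityTheory

namespace GaussianEntire

/-- The law of a standard complex Gaussian: density `π⁻¹ exp (-|z|²)` with respect to the
Lebesgue measure on `ℂ`. -/
noncomputable def stdComplexGaussian : Measure ℂ :=
  (volume : Measure ℂ).withDensity
    (fun z => ENNReal.ofReal (Real.pi⁻¹ * Real.exp (-‖z‖ ^ 2)))

/-- The sequence `ξ` consists of independent standard complex Gaussian random variables. -/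
structure IsIIDStdComplexGaussian {Ω : Type*} [MeasurableSpace Ω] (P : Measure Ω)
    (ξ : ℕ → Ω → ℂ) : Prop where
  measurable : ∀ n, Measurable (ξ n)
  law : ∀ n, P.map (ξ n) = stdComplexGaussian
  indep : iIndepFun ξ P

/-- The random Taylor series `f(z) = ∑ ξₙ aₙ zⁿ`. -/
noncomputable def gaf {Ω : Type*} (a : ℕ → ℝ) (ξ : ℕ → Ω → ℂ) (ω : Ω) (z : ℂ) : ℂ :=
  ∑' n, ξ n ω * (a n : ℂ) * z ^ n

/-- The number of zeros of `f` in the closed disk `{|z| ≤ r}`, counted with multiplicity. -/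
noncomputable def zeroCount (f : ℂ → ℂ) (r : ℝ) : ℕ :=
  ∑ᶠ z ∈ Metric.closedBall (0 : ℂ) r, analyticOrderNatAt f z

/-- The random variable `n_f(r)` for `f = gaf a ξ`. -/
noncomputable def gafZeroCount {Ω : Type*} (a : ℕ → ℝ) (ξ : ℕ → Ω → ℂ) (r : ℝ) (ω : Ω) : ℝ :=
  (zeroCount (gaf a ξ ω) r : ℝ)

/-- The covariance function `G(x) = ∑ aₙ² xⁿ`, on the real line. -/
noncomputable def covFun (a : ℕ → ℝ) (x : ℝ) : ℝ :=
  ∑' n, a n ^ 2 * x ^ n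

/-- `G` has infinite radius of convergence: its power series converges everywhere. -/
def CovEntire (a : ℕ → ℝ) : Prop :=
  ∀ x : ℝ, Summable (fun n => a n ^ 2 * x ^ n)

/-- `a_G(r) = r G'(r) / G(r)`. -/
noncomputable def aFun (a : ℕ → ℝ) (r : ℝ) : ℝ :=
  r * deriv (covFun a) r / covFun a r

/-- `b_G(r) = r a_G'(r)`. -/
noncomputable def bFun (a : ℕ → ℝ) (r : ℝ) : ℝ :=
  r * deriv (aFun a) r

/-- `E ⊆ (0, ∞)` is of finite logarithmic measure: `∫_E dt / t < ∞`. -/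
def FiniteLogMeasure (E : Set ℝ) : Prop :=
  MeasurableSet E ∧ E ⊆ Set.Ioi 0 ∧ ∫⁻ t in E, ENNReal.ofReal (1 / t) < ⊤

/-- `g₁ ≲ g₂` at infinity, outside a set of finite logarithmic measure. The relation concerns
`r → ∞`, so that only `r ≥ 1` is considered (bounded subsets of `[1, ∞)` have finite logarithmic
measure, whereas neighbourhoods of `0` in `(0, ∞)` do not). -/
def LesssimL (g₁ g₂ : ℝ → ℝ) : Prop :=
  ∃ C : ℝ, 0 < C ∧ ∃ E : Set ℝ, FiniteLogMeasure E ∧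
    ∀ r : ℝ, 1 ≤ r → r ∉ E → g₁ r ≤ C * g₂ r

end GaussianEntire

/-! Put `t = log (r²)`. The weights `wₙ = aₙ² exp (n t) / G` form a probability distribution on `ℕ`
with mean `α = a(r²)` and variance `β = b(r²) = α'(t)`. Jensen's formula squeezes `n_f(r)` between
difference quotients of circle averages of `log |f|`. As `f(z)` is Gaussian with variance `G(|z|²)`,
this gives square integrability and the Edelman–Kostlan formula `E n_f(r) = α`
(`integral_gafZeroCount`).

The variance is bounded below by testing against the independent variables `tilt (ξ m)`. Weighting
`P` by `tilt (ξ m)` amounts to halving `a_m²`, so by Edelman–Kostlan for the modified series the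
covariance of `n_f(r)` with `tilt (ξ m)` is the change of `α`, namely `-(m - α) w_m / (2 - w_m)`.
Bessel's inequality then gives `∑ ((m - α) w_m)² ≤ (4/3) Var n_f(r)` (`sum_sq_le_variance`).

If half of `β` comes from indices with `|n - α| ≤ D`, Cauchy–Schwarz gives `β² ≲ D³ ∑ ((n - α) wₙ)²`
(`sq_logVar_le`). The tails are controlled by the moment generating function of the weights, which
is tame as soon as `α` varies by `O(1/δ)` on `[t - δ, t + δ]`. A Borel-type growth lemma
(`exists_finite_measure_levels`) provides this outside a set of finite length in `t`, with `D` about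
`α^(1/2 + o(1))` in general and `D` about `√β` when `b` is monotone.

In the general case the window argument is used for `β ≥ 1`. For `β ≤ 1` the integrality of `n_f(r)`
gives `Var ≥ {α}(1 - {α})`, and `α` moves too slowly in `t` to make this too small only on a set of
finite length (`exists_finite_measure_fract`). -/

namespace GaussianEntire

/-! ### Jensen's formula and the counting function of an entire function. -/

section Zeros

open Metric Real Filter Topology

variable {f : ℂ → ℂ}

lemma analyticOrderAt_ne_top_of_entire (hf : Differentiable ℂ f) (hf0 : ∃ z, f z ≠ 0) (z : ℂ) :
    analyticOrderAt f z ≠ ⊤ := by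
  obtain ⟨w, hw⟩ := hf0
  intro h
  rw [analyticOrderAt_eq_top] at h
  have hA : AnalyticOnNhd ℂ f Set.univ := fun x _ => hf.analyticAt x
  have h0 : Set.EqOn f 0 Set.univ := hA.eqOn_zero_of_preconnected_of_eventuallyEq_zero
    isPreconnected_univ (Set.mem_univ z) h
  exact hw (h0 (Set.mem_univ w))

lemma divisor_closedBall_eq (hf : Differentiable ℂ f) (hf0 : ∃ z, f z ≠ 0) {R : ℝ} {z : ℂ}
    (hz : z ∈ closedBall (0 : ℂ) R) :
    MeromorphicOn.divisor f (closedBall 0 R) z = (analyticOrderNatAt f z : ℤ) := by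
  have hA : AnalyticOnNhd ℂ f (closedBall 0 R) := fun x _ => hf.analyticAt x
  rw [MeromorphicOn.AnalyticOnNhd.divisor_apply hA hz]
  obtain ⟨n, hn⟩ := ENat.ne_top_iff_exists.1 (analyticOrderAt_ne_top_of_entire hf hf0 z)
  rw [analyticOrderNatAt, ← hn]
  rfl

lemma finite_zeros_closedBall (hf : Differentiable ℂ f) (hf0 : ∃ z, f z ≠ 0) (R : ℝ) :
    {z : ℂ | z ∈ closedBall (0 : ℂ) R ∧ analyticOrderNatAt f z ≠ 0}.Finite := by
  refine ((MeromorphicOn.divisor f (closedBall 0 R)).finiteSupport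
    (isCompact_closedBall 0 R)).subset ?_
  rintro z ⟨hz, h⟩
  simpa [divisor_closedBall_eq hf hf0 hz] using h

/-- The zeros of an entire function in a closed disk, as a finite set. -/
noncomputable def zeroFinset (hf : Differentiable ℂ f) (hf0 : ∃ z, f z ≠ 0) (R : ℝ) : Finset ℂ :=
  (finite_zeros_closedBall hf hf0 R).toFinset

lemma mem_zeroFinset (hf : Differentiable ℂ f) (hf0 : ∃ z, f z ≠ 0) {R : ℝ} {z : ℂ} :
    z ∈ zeroFinset hf hf0 R ↔ ‖z‖ ≤ R ∧ analyticOrderNatAt f z ≠ 0 := by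
  simp [zeroFinset]

lemma zeroCount_eq_sum (hf : Differentiable ℂ f) (hf0 : ∃ z, f z ≠ 0) {r R : ℝ} (hr : r ≤ R) :
    zeroCount f r = ∑ z ∈ zeroFinset hf hf0 R, if ‖z‖ ≤ r then analyticOrderNatAt f z else 0 := by
  rw [zeroCount, finsum_mem_def,
    finsum_eq_sum_of_support_subset (s := zeroFinset hf hf0 R)]
  · refine Finset.sum_congr rfl fun z _ => ?_
    by_cases h : ‖z‖ ≤ r <;> simp [h]
  · intro z hz
    have h1 : ‖z‖ ≤ r := by simpa using Set.mem_of_indicator_ne_zero hz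
    rw [Function.mem_support, Set.indicator_of_mem (by simpa using h1)] at hz
    simpa [mem_zeroFinset] using And.intro (h1.trans hr) hz

/-- Jensen's formula over a zero set that does not depend on `r`, so that two radii can be
subtracted term by term and the trailing coefficient cancels. A zero at the origin contributes its
order times `log r`, which the convention `Real.log 0 = 0` encodes in the same sum. -/
lemma circleAverage_log_norm_eq_sum (hf : Differentiable ℂ f) (hf0 : ∃ z, f z ≠ 0) {r R : ℝ}
    (hr0 : 0 < r) (hr : r ≤ R) :
    circleAverage (Real.log ‖f ·‖) 0 r =
      ∑ z ∈ zeroFinset hf hf0 R,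
        (if ‖z‖ ≤ r then (analyticOrderNatAt f z : ℝ) * (Real.log r - Real.log ‖z‖) else 0)
        + Real.log ‖meromorphicTrailingCoeffAt f 0‖ := by
  have hM : MeromorphicOn f (closedBall 0 |r|) := fun x _ => (hf.analyticAt x).meromorphicAt
  rw [MeromorphicOn.circleAverage_log_norm hr0.ne' hM, ← countingFunction_finsum_eq_finsum_add
    hr0.ne' ((MeromorphicOn.divisor f (closedBall 0 |r|)).finiteSupport
      (isCompact_closedBall 0 |r|)), abs_of_pos hr0]
  congr 1
  rw [finsum_eq_sum_of_support_subset (s := zeroFinset hf hf0 R)]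
  · refine Finset.sum_congr rfl fun z _ => ?_
    split_ifs with h
    · rw [divisor_closedBall_eq hf hf0 (by simpa using h)]
      simp
    · rw [Function.locallyFinsuppWithin.apply_eq_zero_of_notMem _ (by simpa using h)]
      simp
  · intro z hz
    have h1 : z ∈ closedBall (0 : ℂ) r := by
      by_contra h
      simp [Function.locallyFinsuppWithin.apply_eq_zero_of_notMem _ h] at hz
    rw [Function.mem_support, divisor_closedBall_eq hf hf0 h1] at hz
    simp only [Finset.mem_coe, mem_zeroFinset]
    refine ⟨(by simpa using h1 : ‖z‖ ≤ r).trans hr, fun h => hz (by simp [h])⟩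

lemma zeroCount_mul_log_le (hf : Differentiable ℂ f) (hf0 : ∃ z, f z ≠ 0) {r s : ℝ}
    (hr0 : 0 < r) (hrs : r ≤ s) :
    zeroCount f r * (Real.log s - Real.log r) ≤
      circleAverage (Real.log ‖f ·‖) 0 s - circleAverage (Real.log ‖f ·‖) 0 r := by
  rw [circleAverage_log_norm_eq_sum hf hf0 hr0 hrs,
    circleAverage_log_norm_eq_sum hf hf0 (hr0.trans_le hrs) le_rfl, zeroCount_eq_sum hf hf0 hrs,
    add_sub_add_right_eq_sub, ← Finset.sum_sub_distrib]
  push_cast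
  rw [Finset.sum_mul]
  refine Finset.sum_le_sum fun z hz => ?_
  have hz := ((mem_zeroFinset hf hf0).1 hz).1
  have hm : (0 : ℝ) ≤ analyticOrderNatAt f z := by positivity
  rw [if_pos hz]
  split_ifs with h
  · linarith
  · have : Real.log ‖z‖ ≤ Real.log s := Real.log_le_log (by linarith) hz
    simp only [zero_mul, sub_zero]
    exact mul_nonneg hm (by linarith)

lemma circleAverage_sub_le_zeroCount_mul_log (hf : Differentiable ℂ f) (hf0 : ∃ z, f z ≠ 0)
    {r s : ℝ} (hr0 : 0 < r) (hrs : r ≤ s) :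
    circleAverage (Real.log ‖f ·‖) 0 s - circleAverage (Real.log ‖f ·‖) 0 r ≤
      zeroCount f s * (Real.log s - Real.log r) := by
  rw [circleAverage_log_norm_eq_sum hf hf0 hr0 hrs,
    circleAverage_log_norm_eq_sum hf hf0 (hr0.trans_le hrs) le_rfl, zeroCount_eq_sum hf hf0 le_rfl,
    add_sub_add_right_eq_sub, ← Finset.sum_sub_distrib]
  push_cast
  rw [Finset.sum_mul]
  refine Finset.sum_le_sum fun z hz => ?_
  have hz := ((mem_zeroFinset hf hf0).1 hz).1
  have hm : (0 : ℝ) ≤ analyticOrderNatAt f z := by positivity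
  rw [if_pos hz, if_pos hz]
  split_ifs with h
  · linarith
  · have : Real.log r ≤ Real.log ‖z‖ := Real.log_le_log hr0 (by linarith)
    rw [sub_zero]
    exact mul_le_mul_of_nonneg_left (by linarith) hm

/-- Zeros are isolated and the disk is closed, so a slight enlargement of the radius captures no new
zero. -/
lemma zeroCount_eventuallyEq_nhdsGT (hf : Differentiable ℂ f) (hf0 : ∃ z, f z ≠ 0) (r : ℝ) :
    ∀ᶠ s in 𝓝[>] r, zeroCount f s = zeroCount f r := by
  have h1 : ∀ᶠ s in 𝓝[>] r, ∀ z ∈ zeroFinset hf hf0 (r + 1), ‖z‖ ≤ s ↔ ‖z‖ ≤ r := by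
    rw [Filter.eventually_all_finset]
    intro z _
    by_cases hz : ‖z‖ ≤ r
    · filter_upwards [self_mem_nhdsWithin] with s hs
      exact iff_of_true (hz.trans (le_of_lt hs)) hz
    · filter_upwards [nhdsWithin_le_nhds (Iio_mem_nhds (not_le.1 hz))] with s hs
      exact iff_of_false (not_le.2 hs) hz
  filter_upwards [h1, nhdsWithin_le_nhds (Iio_mem_nhds (lt_add_one r))] with s hs hs1
  rw [zeroCount_eq_sum hf hf0 (le_of_lt hs1), zeroCount_eq_sum hf hf0 (lt_add_one r).le]
  refine Finset.sum_congr rfl fun z hz => ?_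
  simp [hs z hz]

end Zeros

/-! ### Moments and characteristic function of the standard complex Gaussian. -/

section Gaussian

open Real Filter Topology
open scoped RealInnerProductSpace ComplexConjugate

lemma measurable_gaussianDensity :
    Measurable (fun z : ℂ => ENNReal.ofReal (Real.pi⁻¹ * Real.exp (-‖z‖ ^ 2))) := by fun_prop

lemma integral_stdComplexGaussian {E : Type*} [NormedAddCommGroup E] [NormedSpace ℝ E]
    (g : ℂ → E) :
    ∫ z, g z ∂stdComplexGaussian = ∫ z, (Real.pi⁻¹ * Real.exp (-‖z‖ ^ 2)) • g z := by
  rw [stdComplexGaussian, integral_withDensity_eq_integral_toReal_smul measurable_gaussianDensity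
    (by simp)]
  refine integral_congr_ae (ae_of_all _ fun z => ?_)
  simp only
  rw [ENNReal.toReal_ofReal (by positivity)]

lemma integral_rpow_stdComplexGaussian {q : ℝ} (hq : -2 < q) :
    ∫ z : ℂ, ‖z‖ ^ q ∂stdComplexGaussian = Real.Gamma ((q + 2) / 2) := by
  rw [integral_stdComplexGaussian]
  have h := Complex.integral_rpow_mul_exp_neg_rpow (p := 2) one_le_two hq
  simp only [smul_eq_mul]
  calc ∫ z : ℂ, Real.pi⁻¹ * Real.exp (-‖z‖ ^ 2) * ‖z‖ ^ q
      = ∫ z : ℂ, Real.pi⁻¹ * (‖z‖ ^ q * Real.exp (-‖z‖ ^ (2 : ℝ))) := by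
        refine integral_congr_ae (ae_of_all _ fun z => ?_)
        simp only [Real.rpow_two]
        ring
    _ = _ := by
        rw [integral_const_mul, h]
        field_simp

lemma integrable_rpow_stdComplexGaussian {q : ℝ} (hq : -2 < q) :
    Integrable (fun z : ℂ => ‖z‖ ^ q) stdComplexGaussian := by
  refine Integrable.of_integral_ne_zero ?_
  rw [integral_rpow_stdComplexGaussian hq]
  exact (Real.Gamma_pos_of_pos (by linarith)).ne'

instance : IsProbabilityMeasure stdComplexGaussian := by
  have h := integral_rpow_stdComplexGaussian (q := 0) (by norm_num)
  simp only [rpow_zero, integral_const, smul_eq_mul, mul_one] at h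
  rw [show ((0 : ℝ) + 2) / 2 = 1 by norm_num, Real.Gamma_one] at h
  refine ⟨?_⟩
  rw [measureReal_def, ENNReal.toReal_eq_one_iff] at h
  exact h

lemma charFun_stdComplexGaussian (t : ℂ) :
    charFun stdComplexGaussian t = Complex.exp (-(‖t‖ ^ 2 / 4 : ℝ)) := by
  rw [charFun_apply, integral_stdComplexGaussian]
  have h := GaussianFourier.integral_cexp_neg_mul_sq_norm_add (V := ℂ) (b := 1) (by simp)
    Complex.I t
  calc ∫ z : ℂ, (Real.pi⁻¹ * Real.exp (-‖z‖ ^ 2)) • Complex.exp (⟪z, t⟫ * Complex.I)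
      = ∫ z : ℂ, (Real.pi : ℂ)⁻¹ *
          Complex.exp (-1 * (‖z‖ : ℂ) ^ 2 + Complex.I * (⟪t, z⟫ : ℝ)) := by
        refine integral_congr_ae (ae_of_all _ fun z => ?_)
        simp only [Complex.real_smul]
        push_cast
        rw [Complex.exp_add, real_inner_comm]
        ring_nf
    _ = _ := by
        rw [integral_const_mul, h]
        have : (Real.pi : ℂ) ≠ 0 := by exact_mod_cast Real.pi_ne_zero
        simp [Complex.finrank_real_complex, this]
        ring_nf

/-- Reduces the square integrability of `log |ζ|` to the moments of order `1` and `-1`, both finite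
since they exceed `-2`. -/
lemma sq_log_le {x : ℝ} (hx : 0 ≤ x) : Real.log x ^ 2 ≤ 4 * (x + x⁻¹) := by
  have key : ∀ y : ℝ, 1 ≤ y → Real.log y ^ 2 ≤ 4 * y := by
    intro y hy
    have h1 := Real.add_one_le_exp (Real.log y / 2)
    have h2 : 0 ≤ Real.log y := Real.log_nonneg hy
    have h3 : Real.exp (Real.log y / 2) ^ 2 = y := by
      rw [← Real.exp_nat_mul]
      push_cast
      rw [mul_div_cancel₀ _ (two_ne_zero' ℝ), Real.exp_log (by linarith)]
    nlinarith
  rcases hx.eq_or_lt with rfl | hx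
  · simp
  have hi : 0 < x⁻¹ := inv_pos.2 hx
  rcases le_total 1 x with h | h
  · linarith [key x h]
  · have := key x⁻¹ ((one_le_inv₀ hx).2 h)
    rw [Real.log_inv, neg_sq] at this
    linarith

lemma memLp_log_norm_stdComplexGaussian :
    MemLp (fun z : ℂ => Real.log ‖z‖) 2 stdComplexGaussian := by
  have hm : Measurable (fun z : ℂ => Real.log ‖z‖) := by fun_prop
  rw [memLp_two_iff_integrable_sq hm.aestronglyMeasurable]
  have h1 := integrable_rpow_stdComplexGaussian (q := 1) (by norm_num)
  have h2 := integrable_rpow_stdComplexGaussian (q := -1) (by norm_num)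
  refine ((h1.add h2).const_mul 4).mono' (hm.pow_const 2).aestronglyMeasurable
    (ae_of_all _ fun z => ?_)
  simp only [norm_pow, Real.norm_eq_abs, sq_abs, Pi.add_apply, Real.rpow_one, Real.rpow_neg_one]
  exact sq_log_le (norm_nonneg z)

lemma ae_stdComplexGaussian_ne_zero : ∀ᵐ z ∂stdComplexGaussian, z ≠ 0 := by
  have : ∀ᵐ z : ℂ, z ≠ 0 := by simp [ae_iff]
  exact (withDensity_absolutelyContinuous _ _).ae_le this

/-- `E log |ζ|` for a standard complex Gaussian `ζ`. -/
noncomputable def meanLog : ℝ := ∫ z : ℂ, Real.log ‖z‖ ∂stdComplexGaussian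

end Gaussian

/-! ### Almost sure convergence of the random series and the law of its values. -/

section Series

open Real Filter Topology
open scoped RealInnerProductSpace ComplexConjugate

variable {Ω : Type*} {a : ℕ → ℝ} {ξ : ℕ → Ω → ℂ}

/-- The term is the product of `2ⁿ aₙ Rⁿ` and `2⁻ⁿ`, whose squares are both summable. -/
lemma CovEntire.summable_mul_pow (ha : CovEntire a) (ha0 : ∀ n, 0 ≤ a n) {R : ℝ} (hR : 0 ≤ R) :
    Summable (fun n => a n * R ^ n) := by
  have h := ((ha ((2 * R) ^ 2)).add (summable_geometric_of_lt_one (r := (1 / 4 : ℝ))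
    (by norm_num) (by norm_num)))
  refine Summable.of_nonneg_of_le (fun n => mul_nonneg (ha0 n) (pow_nonneg hR n)) (fun n => ?_) h
  have h1 : a n ^ 2 * ((2 * R) ^ 2) ^ n = (2 ^ n * (a n * R ^ n)) ^ 2 := by
    rw [← pow_mul, mul_comm 2 n, pow_mul, mul_pow]; ring
  have h2 : (1 / 4 : ℝ) ^ n = ((1 / 2) ^ n) ^ 2 := by
    rw [← pow_mul, mul_comm n 2, pow_mul]; norm_num
  have h3 : (2 : ℝ) ^ n * (1 / 2) ^ n = 1 := by rw [← mul_pow]; norm_num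
  simp only [h1, h2]
  nlinarith [sq_nonneg (2 ^ n * (a n * R ^ n) - (1 / 2) ^ n), mul_nonneg (ha0 n) (pow_nonneg hR n)]

/-- The full-measure event on which the random series converges everywhere and is not zero. -/
def Good (a : ℕ → ℝ) (ξ : ℕ → Ω → ℂ) (ω : Ω) : Prop :=
  (∀ R : ℕ, Summable (fun n => ‖ξ n ω‖ * (a n * (R : ℝ) ^ n))) ∧ ∃ n, ξ n ω * (a n : ℂ) ≠ 0

lemma Good.summable {ω : Ω} (h : Good a ξ ω) (ha0 : ∀ n, 0 ≤ a n) (z : ℂ) :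
    Summable (fun n => ξ n ω * (a n : ℂ) * z ^ n) := by
  obtain ⟨R, hR⟩ := exists_nat_ge ‖z‖
  refine Summable.of_norm_bounded (h.1 R) fun n => ?_
  rw [norm_mul, norm_mul, norm_pow, Complex.norm_real, Real.norm_of_nonneg (ha0 n), mul_assoc]
  have := ha0 n
  gcongr

lemma Good.hasFPowerSeriesOnBall {ω : Ω} (h : Good a ξ ω) (ha0 : ∀ n, 0 ≤ a n) :
    HasFPowerSeriesOnBall (gaf a ξ ω)
      (FormalMultilinearSeries.ofScalars ℂ fun n => ξ n ω * (a n : ℂ)) 0 ⊤ := by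
  refine ⟨?_, ENNReal.zero_lt_top, ?_⟩
  · refine top_le_iff.2 (FormalMultilinearSeries.radius_eq_top_of_summable_norm _ fun r => ?_)
    obtain ⟨R, hR⟩ := exists_nat_ge (r : ℝ)
    refine Summable.of_nonneg_of_le (fun n => by positivity) (fun n => ?_) (h.1 R)
    rw [FormalMultilinearSeries.ofScalars_norm, norm_mul, Complex.norm_real,
      Real.norm_of_nonneg (ha0 n), mul_assoc]
    have := ha0 n
    gcongr
  · intro z _
    have := (h.summable ha0 z).hasSum
    simpa [gaf, FormalMultilinearSeries.ofScalars_apply_eq, mul_comm] using this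

lemma Good.differentiable {ω : Ω} (h : Good a ξ ω) (ha0 : ∀ n, 0 ≤ a n) :
    Differentiable ℂ (gaf a ξ ω) := by
  intro z
  exact ((h.hasFPowerSeriesOnBall ha0).analyticAt_of_mem (by simp)).differentiableAt

lemma Good.exists_ne_zero {ω : Ω} (h : Good a ξ ω) (ha0 : ∀ n, 0 ≤ a n) :
    ∃ z, gaf a ξ ω z ≠ 0 := by
  by_contra! h0
  obtain ⟨n, hn⟩ := h.2
  have h1 : gaf a ξ ω = 0 := funext h0
  have h2 := (h.hasFPowerSeriesOnBall ha0).hasFPowerSeriesAt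
  rw [h1] at h2
  have h3 := h2.eq_zero
  refine hn ?_
  have h4 := congrArg (fun p => p.coeff n) h3
  rw [FormalMultilinearSeries.coeff_ofScalars] at h4
  rw [h4]
  simp [FormalMultilinearSeries.coeff]

lemma Good.tendsto_sum {ω : Ω} (h : Good a ξ ω) (ha0 : ∀ n, 0 ≤ a n) (z : ℂ) :
    Tendsto (fun N => ∑ n ∈ Finset.range N, ξ n ω * (a n : ℂ) * z ^ n) atTop
      (𝓝 (gaf a ξ ω z)) :=
  (h.summable ha0 z).hasSum.tendsto_sum_nat

variable [MeasurableSpace Ω] {P : Measure Ω}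

/-- By Tonelli, `E ∑ |ξₙ| aₙ Rⁿ` is the common first absolute moment times `∑ aₙ Rⁿ`, hence finite
for each of the countably many `R`. -/
lemma IsIIDStdComplexGaussian.ae_good (hξ : IsIIDStdComplexGaussian P ξ)
    (ha0 : ∀ n, 0 ≤ a n) (ha : CovEntire a) (hne : ∃ n, a n ≠ 0) : ∀ᵐ ω ∂P, Good a ξ ω := by
  refine Filter.Eventually.and ?_ ?_
  · rw [ae_all_iff]
    intro R
    have hm : ∀ n, Measurable fun ω => ‖ξ n ω‖ₑ * ENNReal.ofReal (a n * (R : ℝ) ^ n) :=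
      fun n => ((hξ.measurable n).enorm).mul_const _
    have h1 : ∀ n, ∫⁻ ω, ‖ξ n ω‖ₑ ∂P = ∫⁻ z, ‖z‖ₑ ∂stdComplexGaussian := by
      intro n
      rw [← hξ.law n, lintegral_map measurable_enorm (hξ.measurable n)]
    have h2 : ∫⁻ z, ‖z‖ₑ ∂stdComplexGaussian < ⊤ := by
      have := (integrable_rpow_stdComplexGaussian (q := 1) (by norm_num)).2
      simpa [HasFiniteIntegral] using this
    have h3 : ∫⁻ ω, ∑' n, ‖ξ n ω‖ₑ * ENNReal.ofReal (a n * (R : ℝ) ^ n) ∂P ≠ ⊤ := by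
      rw [lintegral_tsum fun n => (hm n).aemeasurable]
      have h4 : ∀ n, ∫⁻ ω, ‖ξ n ω‖ₑ * ENNReal.ofReal (a n * (R : ℝ) ^ n) ∂P =
          (∫⁻ z, ‖z‖ₑ ∂stdComplexGaussian) * ENNReal.ofReal (a n * (R : ℝ) ^ n) := fun n => by
        rw [lintegral_mul_const _ (hξ.measurable n).enorm, h1]
      simp_rw [h4, ENNReal.tsum_mul_left]
      refine ENNReal.mul_ne_top h2.ne ?_
      exact (ha.summable_mul_pow ha0 (Nat.cast_nonneg R)).tsum_ofReal_ne_top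
    filter_upwards [ae_lt_top (Measurable.tsum hm) h3] with ω hω
    have h4 : ∀ n, ‖ξ n ω‖ₑ * ENNReal.ofReal (a n * (R : ℝ) ^ n) =
        ENNReal.ofReal (‖ξ n ω‖ * (a n * (R : ℝ) ^ n)) := fun n => by
      rw [ENNReal.ofReal_mul (norm_nonneg _), ofReal_norm]
    simp_rw [h4] at hω
    have h5 := ENNReal.summable_toReal hω.ne
    refine h5.congr fun n => ?_
    rw [ENNReal.toReal_ofReal]
    have := ha0 n
    positivity
  · obtain ⟨n, hn⟩ := hne
    have h0 := ae_stdComplexGaussian_ne_zero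
    rw [← hξ.law n] at h0
    filter_upwards [ae_of_ae_map (hξ.measurable n).aemeasurable h0] with ω hω
    exact ⟨n, mul_ne_zero hω (by exact_mod_cast hn)⟩

lemma IsIIDStdComplexGaussian.aemeasurable_gaf (hξ : IsIIDStdComplexGaussian P ξ)
    (ha0 : ∀ n, 0 ≤ a n) (ha : CovEntire a) (hne : ∃ n, a n ≠ 0) (z : ℂ) :
    AEMeasurable (fun ω => gaf a ξ ω z) P := by
  refine aemeasurable_of_tendsto_metrizable_ae atTop
    (f := fun N ω => ∑ n ∈ Finset.range N, ξ n ω * (a n : ℂ) * z ^ n) (fun N => ?_) ?_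
  · have := hξ.measurable
    fun_prop
  · filter_upwards [hξ.ae_good ha0 ha hne] with ω hω using hω.tendsto_sum ha0 z

lemma inner_mul_right_eq (x c t : ℂ) : ⟪x * c, t⟫ = ⟪x, conj c * t⟫ := by
  simp only [Complex.inner, map_mul]
  ring_nf

/-- The value of the random series at a point is Gaussian with variance `G(|z|²)`. -/
lemma IsIIDStdComplexGaussian.map_gaf [IsProbabilityMeasure P] (hξ : IsIIDStdComplexGaussian P ξ)
    (ha0 : ∀ n, 0 ≤ a n) (ha : CovEntire a) (hne : ∃ n, a n ≠ 0) (z : ℂ) :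
    P.map (fun ω => gaf a ξ ω z) =
      stdComplexGaussian.map (fun w => Real.sqrt (covFun a (‖z‖ ^ 2)) • w) := by
  have hmeas := hξ.aemeasurable_gaf ha0 ha hne z
  have : IsProbabilityMeasure (P.map fun ω => gaf a ξ ω z) := Measure.isProbabilityMeasure_map hmeas
  have : IsProbabilityMeasure
      (stdComplexGaussian.map fun w => Real.sqrt (covFun a (‖z‖ ^ 2)) • w) :=
    Measure.isProbabilityMeasure_map (by fun_prop)
  refine Measure.ext_of_charFun (funext fun t => ?_)
  have hG : 0 ≤ covFun a (‖z‖ ^ 2) := tsum_nonneg fun n => by positivity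
  rw [charFun_map_smul, charFun_stdComplexGaussian, norm_smul, mul_pow, Real.norm_eq_abs, sq_abs,
    Real.sq_sqrt hG]
  -- Independence gives the characteristic functions of the partial sums; dominated convergence then
  -- passes to the limit.
  have hfin : ∀ N, charFun (P.map fun ω => ∑ n ∈ Finset.range N, ξ n ω * (a n : ℂ) * z ^ n) t =
      Complex.exp (-((∑ n ∈ Finset.range N, a n ^ 2 * (‖z‖ ^ 2) ^ n) * ‖t‖ ^ 2 / 4 : ℝ)) := by
    intro N
    have hind : iIndepFun (fun n ω => ξ n ω * (a n : ℂ) * z ^ n) P :=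
      hξ.indep.comp (fun n w => w * (a n : ℂ) * z ^ n) (fun n => by fun_prop)
    have hm : ∀ n, Measurable (fun ω => ξ n ω * (a n : ℂ) * z ^ n) := fun n => by
      have := hξ.measurable n
      fun_prop
    rw [iIndepFun.charFun_map_fun_finsetSum_eq_prod (fun n _ => (hm n).aemeasurable)
      (hind.restrict _), Finset.prod_apply]
    have h1 : ∀ n, charFun (P.map fun ω => ξ n ω * (a n : ℂ) * z ^ n) t =
        Complex.exp (-(a n ^ 2 * (‖z‖ ^ 2) ^ n * ‖t‖ ^ 2 / 4 : ℝ)) := by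
      intro n
      rw [charFun_apply, integral_map (hm n).aemeasurable (by fun_prop)]
      have : ∀ ω, Complex.exp (⟪ξ n ω * (a n : ℂ) * z ^ n, t⟫ * Complex.I) =
          (fun w => Complex.exp (⟪w, conj ((a n : ℂ) * z ^ n) * t⟫ * Complex.I)) (ξ n ω) := by
        intro ω
        simp only
        rw [← inner_mul_right_eq, mul_assoc]
      simp_rw [this]
      rw [← integral_map (φ := ξ n) (f := fun w =>
        Complex.exp (⟪w, conj ((a n : ℂ) * z ^ n) * t⟫ * Complex.I))
        (hξ.measurable n).aemeasurable (by fun_prop), hξ.law n, ← charFun_apply,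
        charFun_stdComplexGaussian]
      congr 4
      simp [mul_pow, ← pow_mul, mul_comm]
    simp_rw [h1, ← Complex.exp_sum]
    congr 1
    push_cast
    rw [Finset.sum_neg_distrib, Finset.sum_mul, Finset.sum_div]
  have hlim1 : Tendsto (fun N => charFun (P.map fun ω =>
      ∑ n ∈ Finset.range N, ξ n ω * (a n : ℂ) * z ^ n) t) atTop
      (𝓝 (charFun (P.map fun ω => gaf a ξ ω z) t)) := by
    have hm : ∀ N, Measurable (fun ω => ∑ n ∈ Finset.range N, ξ n ω * (a n : ℂ) * z ^ n) :=
      fun N => by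
        have := hξ.measurable
        fun_prop
    rw [charFun_apply, integral_map hmeas (by fun_prop)]
    refine Tendsto.congr (fun N => (show _ = charFun (P.map fun ω =>
      ∑ n ∈ Finset.range N, ξ n ω * (a n : ℂ) * z ^ n) t by
        rw [charFun_apply, integral_map (hm N).aemeasurable (by fun_prop)])) ?_
    refine tendsto_integral_of_dominated_convergence (fun _ => 1) (fun N => ?_)
      (integrable_const 1) (fun N => ae_of_all _ fun ω => ?_) ?_
    · have := hm N
      exact Measurable.aestronglyMeasurable (by fun_prop)
    · rw [Complex.norm_exp_ofReal_mul_I]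
    · filter_upwards [hξ.ae_good ha0 ha hne] with ω hω
      have hc : Continuous fun x : ℂ => Complex.exp (⟪x, t⟫ * Complex.I) := by fun_prop
      exact (hc.tendsto _).comp (hω.tendsto_sum ha0 z)
  refine tendsto_nhds_unique hlim1 ?_
  simp_rw [hfin]
  have hs := (ha (‖z‖ ^ 2)).hasSum.tendsto_sum_nat
  have hc : Continuous fun x : ℝ => Complex.exp (-(x * ‖t‖ ^ 2 / 4 : ℝ)) := by fun_prop
  exact (hc.tendsto _).comp hs

end Series

/-! ### The functions `a` and `b` as mean and variance of the weights, and concentration of the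
weights. -/

section Covariance

open Real Filter Topology

/-- The moment series `∑ nᵏ aₙ² exp (n t)`. -/
noncomputable def momentSeries (a : ℕ → ℝ) (k : ℕ) (t : ℝ) : ℝ :=
  ∑' n : ℕ, (n : ℝ) ^ k * (a n ^ 2 * Real.exp (n * t))

/-- The probability weights `aₙ² xⁿ / G(x)` at `x = exp t`. -/
noncomputable def weight (a : ℕ → ℝ) (t : ℝ) (n : ℕ) : ℝ :=
  a n ^ 2 * Real.exp (n * t) / momentSeries a 0 t

/-- The function `a_G` in the logarithmic variable. -/
noncomputable def logMean (a : ℕ → ℝ) (t : ℝ) : ℝ := aFun a (Real.exp t)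

/-- The function `b_G` in the logarithmic variable. -/
noncomputable def logVar (a : ℕ → ℝ) (t : ℝ) : ℝ := bFun a (Real.exp t)

variable {a : ℕ → ℝ}

lemma CovEntire.summable_moment (ha : CovEntire a) (k : ℕ) (t : ℝ) :
    Summable (fun n : ℕ => (n : ℝ) ^ k * (a n ^ 2 * Real.exp (n * t))) := by
  have h1 : Summable (fun n : ℕ => (n : ℝ) ^ k * (1 / 2 : ℝ) ^ n) :=
    summable_pow_mul_geometric_of_norm_lt_one k (by norm_num)
  obtain ⟨C, hC⟩ := h1.tendsto_atTop_zero.bddAbove_range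
  refine Summable.of_nonneg_of_le (fun n => by positivity) (fun n => ?_)
    ((ha (2 * Real.exp t)).mul_left C)
  have h2 : (n : ℝ) ^ k * (1 / 2 : ℝ) ^ n ≤ C := hC ⟨n, rfl⟩
  have h3 : Real.exp (n * t) = (1 / 2 : ℝ) ^ n * (2 * Real.exp t) ^ n := by
    rw [← mul_pow, Real.exp_nat_mul]; ring
  calc (n : ℝ) ^ k * (a n ^ 2 * Real.exp (n * t))
      = ((n : ℝ) ^ k * (1 / 2 : ℝ) ^ n) * (a n ^ 2 * (2 * Real.exp t) ^ n) := by rw [h3]; ring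
    _ ≤ _ := mul_le_mul_of_nonneg_right h2 (by positivity)

lemma CovEntire.hasDerivAt_momentSeries (ha : CovEntire a) (k : ℕ) (t : ℝ) :
    HasDerivAt (momentSeries a k) (momentSeries a (k + 1) t) t := by
  refine hasDerivAt_tsum_of_isPreconnected
    (g := fun (n : ℕ) (y : ℝ) => (n : ℝ) ^ k * (a n ^ 2 * Real.exp (n * y)))
    (g' := fun (n : ℕ) (y : ℝ) => (n : ℝ) ^ (k + 1) * (a n ^ 2 * Real.exp (n * y)))
    (ha.summable_moment (k + 1) (t + 1))
    (t := Set.Iio (t + 1)) (y₀ := t) isOpen_Iio isPreconnected_Iio (fun n y _ => ?_)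
    (fun n y hy => ?_) (by simp) (ha.summable_moment k t) (by simp)
  · have h := (((hasDerivAt_id y).const_mul (n : ℝ)).exp.const_mul (a n ^ 2)).const_mul
      ((n : ℝ) ^ k)
    simp only [id, mul_one] at h
    refine h.congr_deriv ?_
    ring
  · rw [Real.norm_of_nonneg (by positivity)]
    have : y ≤ t + 1 := le_of_lt hy
    gcongr

lemma covFun_exp (t : ℝ) : covFun a (Real.exp t) = momentSeries a 0 t := by
  simp [covFun, momentSeries, Real.exp_nat_mul]

lemma CovEntire.momentSeries_pos (ha : CovEntire a) (hne : ∃ n, a n ≠ 0) (t : ℝ) :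
    0 < momentSeries a 0 t := by
  obtain ⟨n, hn⟩ := hne
  refine (ha.summable_moment 0 t).tsum_pos (fun n => by positivity) n ?_
  have : 0 < a n ^ 2 := by positivity
  positivity

lemma CovEntire.covFun_pos (ha : CovEntire a) (hne : ∃ n, a n ≠ 0) {x : ℝ} (hx : 0 < x) :
    0 < covFun a x := by
  rw [← Real.exp_log hx, covFun_exp]
  exact ha.momentSeries_pos hne _

lemma CovEntire.hasDerivAt_covFun (ha : CovEntire a) {x : ℝ} (hx : 0 < x) :
    HasDerivAt (covFun a) (momentSeries a 1 (Real.log x) / x) x := by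
  have h := (ha.hasDerivAt_momentSeries 0 (Real.log x)).comp x (Real.hasDerivAt_log hx.ne')
  rw [div_eq_mul_inv]
  refine h.congr_of_eventuallyEq ?_
  filter_upwards [Ioi_mem_nhds hx] with y hy
  rw [Function.comp_apply, ← covFun_exp, Real.exp_log hy]

lemma CovEntire.aFun_eq (ha : CovEntire a) {x : ℝ} (hx : 0 < x) :
    aFun a x = momentSeries a 1 (Real.log x) / momentSeries a 0 (Real.log x) := by
  rw [aFun, (ha.hasDerivAt_covFun hx).deriv, ← covFun_exp, Real.exp_log hx,
    mul_div_cancel₀ _ hx.ne']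

lemma CovEntire.logMean_eq (ha : CovEntire a) (t : ℝ) :
    logMean a t = momentSeries a 1 t / momentSeries a 0 t := by
  rw [logMean, ha.aFun_eq (Real.exp_pos t), Real.log_exp]

lemma CovEntire.hasDerivAt_mean_aux (ha : CovEntire a) (hne : ∃ n, a n ≠ 0) (t : ℝ) :
    HasDerivAt (fun t => momentSeries a 1 t / momentSeries a 0 t)
      (momentSeries a 2 t / momentSeries a 0 t - (logMean a t) ^ 2) t := by
  have h0 := (ha.momentSeries_pos hne t).ne'
  refine ((ha.hasDerivAt_momentSeries 1 t).div (ha.hasDerivAt_momentSeries 0 t) h0).congr_deriv ?_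
  rw [ha.logMean_eq]
  field_simp

lemma CovEntire.logVar_eq (ha : CovEntire a) (hne : ∃ n, a n ≠ 0) (t : ℝ) :
    logVar a t = momentSeries a 2 t / momentSeries a 0 t - (logMean a t) ^ 2 := by
  have hx := Real.exp_pos t
  have h : HasDerivAt (aFun a)
      ((momentSeries a 2 t / momentSeries a 0 t - (logMean a t) ^ 2) * (Real.exp t)⁻¹)
      (Real.exp t) := by
    have h1 := ha.hasDerivAt_mean_aux hne t
    rw [← Real.log_exp t] at h1
    have h2 := h1.comp (Real.exp t) (Real.hasDerivAt_log hx.ne')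
    rw [Real.log_exp] at h2
    refine h2.congr_of_eventuallyEq ?_
    filter_upwards [Ioi_mem_nhds hx] with y hy
    exact ha.aFun_eq hy
  rw [logVar, bFun, h.deriv]
  field_simp

lemma CovEntire.hasDerivAt_logMean (ha : CovEntire a) (hne : ∃ n, a n ≠ 0) (t : ℝ) :
    HasDerivAt (logMean a) (logVar a t) t := by
  rw [ha.logVar_eq hne]
  exact (ha.hasDerivAt_mean_aux hne t).congr_of_eventuallyEq
    (Eventually.of_forall fun s => ha.logMean_eq s)

lemma CovEntire.hasDerivAt_log_momentSeries (ha : CovEntire a) (hne : ∃ n, a n ≠ 0) (t : ℝ) :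
    HasDerivAt (fun t => Real.log (momentSeries a 0 t)) (logMean a t) t := by
  rw [ha.logMean_eq]
  exact (ha.hasDerivAt_momentSeries 0 t).log (ha.momentSeries_pos hne t).ne'

lemma CovEntire.weight_nonneg (ha : CovEntire a) (hne : ∃ n, a n ≠ 0) (t : ℝ) (n : ℕ) :
    0 ≤ weight a t n := by
  have := (ha.momentSeries_pos hne t).le
  unfold weight
  positivity

lemma CovEntire.hasSum_pow_mul_weight (ha : CovEntire a) (k : ℕ) (t : ℝ) :
    HasSum (fun n : ℕ => (n : ℝ) ^ k * weight a t n)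
      (momentSeries a k t / momentSeries a 0 t) := by
  have := (ha.summable_moment k t).hasSum.div_const (momentSeries a 0 t)
  simp only [weight, ← mul_div_assoc]
  exact this

lemma CovEntire.hasSum_weight (ha : CovEntire a) (hne : ∃ n, a n ≠ 0) (t : ℝ) :
    HasSum (weight a t) 1 := by
  have := ha.hasSum_pow_mul_weight 0 t
  simpa [div_self (ha.momentSeries_pos hne t).ne'] using this

/-- The weights form an exponential family with log-partition function `log G(exp t)`; its second
derivative is the variance. -/
lemma CovEntire.hasSum_sq_mul_weight (ha : CovEntire a) (hne : ∃ n, a n ≠ 0) (t : ℝ) :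
    HasSum (fun n : ℕ => ((n : ℝ) - logMean a t) ^ 2 * weight a t n) (logVar a t) := by
  have h0 := (ha.hasSum_weight hne t).mul_left (logMean a t ^ 2)
  have h1 := (ha.hasSum_pow_mul_weight 1 t).mul_left (-2 * logMean a t)
  have h2 := ha.hasSum_pow_mul_weight 2 t
  have h := (h2.add h1).add h0
  rw [← ha.logMean_eq] at h
  convert! h using 1
  · ext n; ring
  · rw [ha.logVar_eq hne]; ring

lemma CovEntire.weight_pos (ha : CovEntire a) {n : ℕ} (hn : a n ≠ 0) (t : ℝ) :
    0 < weight a t n := by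
  have := ha.momentSeries_pos ⟨n, hn⟩ t
  have : 0 < a n ^ 2 := by positivity
  unfold weight
  positivity

lemma CovEntire.logVar_pos (ha : CovEntire a) (hinf : {n : ℕ | a n ≠ 0}.Infinite) (t : ℝ) :
    0 < logVar a t := by
  obtain ⟨n, hn⟩ := hinf.nonempty
  obtain ⟨N, hN⟩ := exists_nat_gt (logMean a t)
  obtain ⟨m, hm, hNm⟩ := hinf.exists_gt N
  have h := ha.hasSum_sq_mul_weight ⟨n, hn⟩ t
  rw [← h.tsum_eq]
  refine h.summable.tsum_pos
    (fun k => mul_nonneg (sq_nonneg _) (ha.weight_nonneg ⟨n, hn⟩ t k)) m ?_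
  have h1 : (N : ℝ) < m := by exact_mod_cast hNm
  have h2 : 0 < (m : ℝ) - logMean a t := by linarith
  exact mul_pos (by positivity) (ha.weight_pos hm t)

lemma CovEntire.strictMono_logMean (ha : CovEntire a) (hinf : {n : ℕ | a n ≠ 0}.Infinite) :
    StrictMono (logMean a) :=
  strictMono_of_hasDerivAt_pos (ha.hasDerivAt_logMean hinf.nonempty) (ha.logVar_pos hinf)

lemma CovEntire.continuous_logMean (ha : CovEntire a) (hne : ∃ n, a n ≠ 0) :
    Continuous (logMean a) :=
  continuous_iff_continuousAt.2 fun t => (ha.hasDerivAt_logMean hne t).continuousAt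

lemma CovEntire.logMean_nonneg (ha : CovEntire a) (hne : ∃ n, a n ≠ 0) (t : ℝ) :
    0 ≤ logMean a t := by
  rw [ha.logMean_eq]
  exact div_nonneg (tsum_nonneg fun n => by positivity) (ha.momentSeries_pos hne t).le

/-- A bound `B` on the mean would force `log G(exp t) ≤ B t + O(1)` for `t ≥ 0`, against a single
nonzero term of index `m > B`. -/
lemma CovEntire.tendsto_logMean (ha : CovEntire a) (hinf : {n : ℕ | a n ≠ 0}.Infinite) :
    Tendsto (logMean a) atTop atTop := by
  have hmono := (ha.strictMono_logMean hinf).monotone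
  refine tendsto_atTop_atTop_of_monotone hmono fun b => ?_
  by_contra! hb
  obtain ⟨B, hB⟩ := exists_nat_gt b
  obtain ⟨m, hm, hBm⟩ := hinf.exists_gt B
  have hb' : ∀ t, logMean a t ≤ B := fun t => ((hb t).trans hB).le
  have hlog : ∀ t : ℝ, 0 ≤ t → Real.log (momentSeries a 0 t) ≤
      Real.log (momentSeries a 0 0) + B * t := by
    intro t ht
    have h := Convex.image_sub_le_mul_sub_of_deriv_le (convex_univ (𝕜 := ℝ) (E := ℝ))
      (f := fun t => Real.log (momentSeries a 0 t))
      (fun s _ => (ha.hasDerivAt_log_momentSeries hinf.nonempty s).continuousAt.continuousWithinAt)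
      (fun s _ => (ha.hasDerivAt_log_momentSeries
        hinf.nonempty s).differentiableAt.differentiableWithinAt)
      (fun s _ => by
        rw [(ha.hasDerivAt_log_momentSeries hinf.nonempty s).deriv]; exact hb' s)
      0 (Set.mem_univ _) t (Set.mem_univ _) ht
    simp only [sub_zero] at h
    linarith
  have hlow : ∀ t : ℝ, Real.log (a m ^ 2) + m * t ≤ Real.log (momentSeries a 0 t) := by
    intro t
    have ham : 0 < a m ^ 2 := by have : a m ≠ 0 := hm; positivity
    have h1 : a m ^ 2 * Real.exp (m * t) ≤ momentSeries a 0 t := by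
      have := (ha.summable_moment 0 t).le_tsum m (fun n _ => by positivity)
      simpa [momentSeries] using this
    have h2 := Real.log_le_log (by positivity) h1
    rwa [Real.log_mul ham.ne' (Real.exp_pos _).ne', Real.log_exp] at h2
  have hBm' : (B : ℝ) + 1 ≤ m := by exact_mod_cast hBm
  set T : ℝ := |Real.log (momentSeries a 0 0) - Real.log (a m ^ 2)| + 1 with hT
  have hT0 : 0 ≤ T := by positivity
  have := le_abs_self (Real.log (momentSeries a 0 0) - Real.log (a m ^ 2))
  nlinarith [hlog T hT0, hlow T]

lemma CovEntire.hasSum_exp_mul_weight (ha : CovEntire a) (hne : ∃ n, a n ≠ 0) (t δ : ℝ) :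
    HasSum (fun n : ℕ => Real.exp (δ * (n - logMean a t)) * weight a t n)
      (Real.exp (Real.log (momentSeries a 0 (t + δ)) - Real.log (momentSeries a 0 t)
        - δ * logMean a t)) := by
  have h := ((ha.summable_moment 0 (t + δ)).hasSum.div_const (momentSeries a 0 t)).mul_left
    (Real.exp (-(δ * logMean a t)))
  rw [show ∑' n : ℕ, (n : ℝ) ^ 0 * (a n ^ 2 * Real.exp (n * (t + δ))) =
    momentSeries a 0 (t + δ) from rfl] at h
  convert! h using 1
  · ext n
    rw [weight, mul_sub, sub_eq_add_neg, Real.exp_add, mul_add, Real.exp_add, pow_zero, one_mul,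
      mul_comm δ (n : ℝ)]
    ring
  · rw [Real.exp_sub, Real.exp_sub, Real.exp_log (ha.momentSeries_pos hne _),
      Real.exp_log (ha.momentSeries_pos hne _), Real.exp_neg]
    ring

/-- Convexity of `log G(exp t)`: its chord over `[t, t + δ]` is compared with the slope at `t + δ`,
for either sign of `δ`. The left side is the logarithm of the centred moment generating function of
the weights. -/
lemma CovEntire.log_momentSeries_sub_le (ha : CovEntire a) (hinf : {n : ℕ | a n ≠ 0}.Infinite)
    (t δ : ℝ) :
    Real.log (momentSeries a 0 (t + δ)) - Real.log (momentSeries a 0 t) - δ * logMean a t ≤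
      δ * (logMean a (t + δ) - logMean a t) := by
  have hd := ha.hasDerivAt_log_momentSeries hinf.nonempty
  have hmono := (ha.strictMono_logMean hinf).monotone
  have hconv : ConvexOn ℝ Set.univ (fun t => Real.log (momentSeries a 0 t)) := by
    refine MonotoneOn.convexOn_of_deriv convex_univ
      (fun s _ => (hd s).continuousAt.continuousWithinAt)
      (fun s _ => (hd s).differentiableAt.differentiableWithinAt) ?_
    intro s _ u _ hsu
    rw [(hd s).deriv, (hd u).deriv]
    exact hmono hsu
  have key : Real.log (momentSeries a 0 (t + δ)) - Real.log (momentSeries a 0 t) ≤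
      δ * logMean a (t + δ) := by
    rcases lt_trichotomy δ 0 with h | rfl | h
    · have := hconv.le_slope_of_hasDerivAt (Set.mem_univ (t + δ)) (Set.mem_univ t) (by linarith)
        (hd (t + δ))
      rw [slope_def_field, le_div_iff₀ (by linarith)] at this
      linarith
    · simp
    · have := hconv.slope_le_of_hasDerivAt (Set.mem_univ t) (Set.mem_univ (t + δ)) (by linarith)
        (hd (t + δ))
      rw [slope_def_field, div_le_iff₀ (by linarith)] at this
      linarith
  linarith

/-- The integers at distance at most `D` from the mean. -/
noncomputable def window (a : ℕ → ℝ) (t D : ℝ) : Finset ℕ :=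
  Finset.Icc ⌈logMean a t - D⌉₊ ⌊logMean a t + D⌋₊

lemma mem_window (hα : 0 ≤ logMean a t) {D : ℝ} (hD : 0 ≤ D) {n : ℕ} :
    n ∈ window a t D ↔ |(n : ℝ) - logMean a t| ≤ D := by
  rw [window, Finset.mem_Icc, Nat.ceil_le, Nat.le_floor_iff (by linarith), abs_le]
  constructor <;> rintro ⟨h1, h2⟩ <;> constructor <;> linarith

lemma card_window_le (hα : 0 ≤ logMean a t) {D : ℝ} (hD : 0 ≤ D) :
    ((window a t D).card : ℝ) ≤ 2 * D + 1 := by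
  rw [window, Nat.card_Icc]
  have h1 := Nat.floor_le (show 0 ≤ logMean a t + D by linarith)
  have h2 := Nat.le_ceil (logMean a t - D)
  rcases le_total ⌈logMean a t - D⌉₊ (⌊logMean a t + D⌋₊ + 1) with h | h
  · rw [Nat.cast_sub h]
    push_cast
    linarith
  · rw [Nat.sub_eq_zero_of_le h, Nat.cast_zero]
    linarith

lemma sq_le_exp_half {y : ℝ} (hy : 0 ≤ y) : y ^ 2 ≤ 8 * Real.exp (y / 2) := by
  have := Real.quadratic_le_exp_of_nonneg (x := y / 2) (by linarith)
  nlinarith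

/-- A Chernoff bound. With `x = n - α` and `|x| > D`, `x²` is at most `(8/δ²) exp (δ|x|/2)`, hence
at most `(8/δ²) exp (-δD/2) (exp (δx) + exp (-δx))`; both moment generating functions are at most
`exp Λ`. -/
lemma CovEntire.logVar_le_window_add (ha : CovEntire a) (hinf : {n : ℕ | a n ≠ 0}.Infinite)
    {t δ Λ D : ℝ} (hδ : 0 < δ) (hD : 0 ≤ D)
    (hup : δ * (logMean a (t + δ) - logMean a t) ≤ Λ)
    (hlo : δ * (logMean a t - logMean a (t - δ)) ≤ Λ) :
    logVar a t ≤ ∑ n ∈ window a t D, ((n : ℝ) - logMean a t) ^ 2 * weight a t n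
      + 16 / δ ^ 2 * Real.exp (Λ - δ * D / 2) := by
  have hne := hinf.nonempty
  have hα := ha.logMean_nonneg hne t
  set c : ℝ := 8 / δ ^ 2 * Real.exp (-(δ * D / 2)) with hc
  have hc0 : 0 ≤ c := by positivity
  have hsum := ha.hasSum_sq_mul_weight hne t
  have he1 := ha.hasSum_exp_mul_weight hne t δ
  have he2 := ha.hasSum_exp_mul_weight hne t (-δ)
  have hW : HasSum (fun n : ℕ => if n ∈ window a t D then
      ((n : ℝ) - logMean a t) ^ 2 * weight a t n else 0)
      (∑ n ∈ window a t D, ((n : ℝ) - logMean a t) ^ 2 * weight a t n) := by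
    have := hasSum_sum_of_ne_finset_zero (L := SummationFilter.unconditional ℕ)
      (s := window a t D) (f := fun n : ℕ =>
      if n ∈ window a t D then ((n : ℝ) - logMean a t) ^ 2 * weight a t n else 0)
      (fun n hn => by simp [hn])
    rwa [Finset.sum_congr rfl (fun n hn => if_pos hn)] at this
  have hR := hW.add ((he1.add he2).mul_left c)
  refine le_trans (hasSum_le (L := SummationFilter.unconditional ℕ) (fun n => ?_) hsum hR) ?_
  rotate_left
  · have e1 := Real.exp_le_exp.2 ((ha.log_momentSeries_sub_le hinf t δ).trans hup)
    have e2 := Real.exp_le_exp.2 ((ha.log_momentSeries_sub_le hinf t (-δ)).trans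
      (show -δ * (logMean a (t + -δ) - logMean a t) ≤ Λ by
        rw [← sub_eq_add_neg]; linarith))
    have e3 : 16 / δ ^ 2 * Real.exp (Λ - δ * D / 2) = c * (Real.exp Λ + Real.exp Λ) := by
      rw [hc, sub_eq_add_neg, Real.exp_add]; ring
    rw [e3]
    gcongr
  · have hw := ha.weight_nonneg hne t n
    by_cases hn : n ∈ window a t D
    · simp only [hn, if_true, le_add_iff_nonneg_right]
      positivity
    · simp only [hn, if_false, zero_add, ← add_mul, ← mul_assoc]
      refine mul_le_mul_of_nonneg_right ?_ hw
      rw [mem_window hα hD, not_le] at hn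
      set x : ℝ := (n : ℝ) - logMean a t
      have h1 := sq_le_exp_half (y := δ * |x|) (by positivity)
      rw [mul_pow, sq_abs] at h1
      have h2 : Real.exp (δ * |x| / 2) ≤ Real.exp (-(δ * D / 2)) * Real.exp (δ * |x|) := by
        rw [← Real.exp_add]
        refine Real.exp_le_exp.2 ?_
        nlinarith
      have h3 : Real.exp (δ * |x|) ≤ Real.exp (δ * x) + Real.exp (-δ * x) := by
        rcases abs_cases x with ⟨h, _⟩ | ⟨h, _⟩ <;> rw [h]
        · linarith [Real.exp_pos (-δ * x)]
        · rw [mul_neg, ← neg_mul]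
          linarith [Real.exp_pos (δ * x)]
      calc x ^ 2 = (δ ^ 2 * x ^ 2) / δ ^ 2 := by field_simp
        _ ≤ (8 * (Real.exp (-(δ * D / 2)) * (Real.exp (δ * x) + Real.exp (-δ * x)))) / δ ^ 2 := by
          refine div_le_div_of_nonneg_right ?_ (by positivity)
          refine h1.trans ?_
          gcongr
          exact h2.trans (by gcongr)
        _ = _ := by rw [hc]; ring

/-- With the tail at most half of the variance, Cauchy–Schwarz applies to the rest, split as `(n -
α) · ((n - α) wₙ)`; the window has at most `2D + 1` points. -/
lemma CovEntire.sq_logVar_le (ha : CovEntire a) (hinf : {n : ℕ | a n ≠ 0}.Infinite)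
    {t δ Λ D : ℝ} (hδ : 0 < δ) (hD : 0 ≤ D)
    (hup : δ * (logMean a (t + δ) - logMean a t) ≤ Λ)
    (hlo : δ * (logMean a t - logMean a (t - δ)) ≤ Λ)
    (htail : 16 / δ ^ 2 * Real.exp (Λ - δ * D / 2) ≤ logVar a t / 2) :
    logVar a t ^ 2 ≤ 4 * ((2 * D + 1) * D ^ 2) *
      ∑ n ∈ window a t D, (((n : ℝ) - logMean a t) * weight a t n) ^ 2 := by
  have hα := ha.logMean_nonneg hinf.nonempty t
  have h1 := ha.logVar_le_window_add hinf hδ hD hup hlo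
  have h2 := Finset.sum_mul_sq_le_sq_mul_sq (window a t D)
    (fun n : ℕ => (n : ℝ) - logMean a t) (fun n => ((n : ℝ) - logMean a t) * weight a t n)
  have h3 : ∑ n ∈ window a t D, ((n : ℝ) - logMean a t) ^ 2 ≤ (2 * D + 1) * D ^ 2 := by
    calc ∑ n ∈ window a t D, ((n : ℝ) - logMean a t) ^ 2
        ≤ ∑ n ∈ window a t D, D ^ 2 := by
          refine Finset.sum_le_sum fun n hn => ?_
          rw [← sq_abs]
          exact pow_le_pow_left₀ (abs_nonneg _) ((mem_window hα hD).1 hn) 2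
      _ ≤ _ := by
          rw [Finset.sum_const, nsmul_eq_mul]
          exact mul_le_mul_of_nonneg_right (card_window_le hα hD) (by positivity)
  have h4 : ∑ n ∈ window a t D, ((n : ℝ) - logMean a t) * (((n : ℝ) - logMean a t) * weight a t n)
      = ∑ n ∈ window a t D, ((n : ℝ) - logMean a t) ^ 2 * weight a t n :=
    Finset.sum_congr rfl fun n _ => by ring
  rw [h4] at h2
  have hS : 0 ≤ ∑ n ∈ window a t D, (((n : ℝ) - logMean a t) * weight a t n) ^ 2 :=
    Finset.sum_nonneg fun n _ => sq_nonneg _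
  have h5 : logVar a t / 2 ≤
      ∑ n ∈ window a t D, ((n : ℝ) - logMean a t) ^ 2 * weight a t n := by linarith
  have h6 := pow_le_pow_left₀ (by linarith [ha.logVar_pos hinf t]) h5 2
  nlinarith [mul_le_mul_of_nonneg_right h3 hS]

end Covariance

/-! ### Circle averages of `log |f|`: square integrability and mean. -/

section LogAverage

open Real Filter Topology

variable {Ω : Type*} [MeasurableSpace Ω] {P : Measure Ω} {a : ℕ → ℝ} {ξ : ℕ → Ω → ℂ}

/-- The mean of `log |f|` over the circle of radius `r`. -/
noncomputable def logAverage {Ω : Type*} (a : ℕ → ℝ) (ξ : ℕ → Ω → ℂ) (r : ℝ) (ω : Ω) : ℝ :=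
  circleAverage (fun z => Real.log ‖gaf a ξ ω z‖) 0 r

/-- The uniform probability measure on `(0, 2π]`. -/
noncomputable def angleMeasure : Measure ℝ := volume[|Set.Ioc 0 (2 * Real.pi)]

instance : IsProbabilityMeasure angleMeasure := by
  refine cond_isProbabilityMeasure_of_finite ?_ ?_
  · simp [Real.pi_pos]
  · exact measure_Ioc_lt_top.ne

lemma circleAverage_eq_integral_angleMeasure (g : ℂ → ℝ) (r : ℝ) :
    circleAverage g 0 r = ∫ θ, g (circleMap 0 r θ) ∂angleMeasure := by
  rw [circleAverage_def, angleMeasure, ProbabilityTheory.cond, integral_smul_measure,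
    intervalIntegral.integral_of_le (by positivity), Real.volume_Ioc, sub_zero, ENNReal.toReal_inv,
    ENNReal.toReal_ofReal (by positivity)]

lemma covFun_sq_pos {a : ℕ → ℝ} (ha : CovEntire a) (hne : ∃ n, a n ≠ 0) {z : ℂ} (hz : z ≠ 0) :
    0 < covFun a (‖z‖ ^ 2) := ha.covFun_pos hne (by positivity)

lemma log_norm_smul_ae_eq {c : ℝ} (hc : 0 < c) :
    (fun w : ℂ => Real.log ‖Real.sqrt c • w‖) =ᵐ[stdComplexGaussian]
      fun w => Real.log c / 2 + Real.log ‖w‖ := by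
  filter_upwards [ae_stdComplexGaussian_ne_zero] with w hw
  have h1 : Real.sqrt c ≠ 0 := (Real.sqrt_pos.2 hc).ne'
  rw [norm_smul, Real.norm_of_nonneg (Real.sqrt_nonneg c), Real.log_mul h1 (norm_ne_zero_iff.2 hw),
    Real.log_sqrt hc.le]

variable [IsProbabilityMeasure P]

lemma IsIIDStdComplexGaussian.integral_comp_log_norm_gaf (hξ : IsIIDStdComplexGaussian P ξ)
    (ha0 : ∀ n, 0 ≤ a n) (ha : CovEntire a) (hne : ∃ n, a n ≠ 0) {z : ℂ} (hz : z ≠ 0)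
    {φ : ℝ → ℝ} (hφ : Measurable φ) :
    ∫ ω, φ (Real.log ‖gaf a ξ ω z‖) ∂P =
      ∫ w, φ (Real.log (covFun a (‖z‖ ^ 2)) / 2 + Real.log ‖w‖) ∂stdComplexGaussian := by
  have hm : Measurable fun w : ℂ => φ (Real.log ‖w‖) := by fun_prop
  rw [← integral_map (f := fun w : ℂ => φ (Real.log ‖w‖)) (hξ.aemeasurable_gaf ha0 ha hne z)
    hm.aestronglyMeasurable, hξ.map_gaf ha0 ha hne, integral_map (by fun_prop)
    hm.aestronglyMeasurable]
  refine integral_congr_ae ?_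
  filter_upwards [log_norm_smul_ae_eq (covFun_sq_pos ha hne hz)] with w hw
  rw [hw]

lemma IsIIDStdComplexGaussian.memLp_log_norm_gaf (hξ : IsIIDStdComplexGaussian P ξ)
    (ha0 : ∀ n, 0 ≤ a n) (ha : CovEntire a) (hne : ∃ n, a n ≠ 0) {z : ℂ} (hz : z ≠ 0) :
    MemLp (fun ω => Real.log ‖gaf a ξ ω z‖) 2 P := by
  have hm : Measurable fun w : ℂ => Real.log ‖w‖ := by fun_prop
  have h : MemLp (fun w : ℂ => Real.log ‖w‖) 2 (P.map fun ω => gaf a ξ ω z) := by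
    rw [hξ.map_gaf ha0 ha hne, memLp_map_measure_iff hm.aestronglyMeasurable (by fun_prop)]
    have h1 : MemLp (fun w : ℂ => Real.log (covFun a (‖z‖ ^ 2)) / 2 + Real.log ‖w‖) 2
        stdComplexGaussian := MemLp.add (memLp_const _) memLp_log_norm_stdComplexGaussian
    exact h1.ae_eq (log_norm_smul_ae_eq (covFun_sq_pos ha hne hz)).symm
  rwa [memLp_map_measure_iff hm.aestronglyMeasurable (hξ.aemeasurable_gaf ha0 ha hne z)] at h

lemma IsIIDStdComplexGaussian.integral_log_norm_gaf (hξ : IsIIDStdComplexGaussian P ξ)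
    (ha0 : ∀ n, 0 ≤ a n) (ha : CovEntire a) (hne : ∃ n, a n ≠ 0) {z : ℂ} (hz : z ≠ 0) :
    ∫ ω, Real.log ‖gaf a ξ ω z‖ ∂P = Real.log (covFun a (‖z‖ ^ 2)) / 2 + meanLog := by
  have h := hξ.integral_comp_log_norm_gaf ha0 ha hne hz (φ := fun x => x) measurable_id
  rw [h, integral_add (integrable_const _)
    (memLp_log_norm_stdComplexGaussian.integrable one_le_two)]
  simp [meanLog]

/-- The second moment of `log |f(z)|` depends only on `|z|`, so it is constant in the angle. -/
lemma IsIIDStdComplexGaussian.memLp_log_norm_gaf_prod (hξ : IsIIDStdComplexGaussian P ξ)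
    (ha0 : ∀ n, 0 ≤ a n) (ha : CovEntire a) (hne : ∃ n, a n ≠ 0) {r : ℝ} (hr : 0 < r) :
    MemLp (fun p : Ω × ℝ => Real.log ‖gaf a ξ p.1 (circleMap 0 r p.2)‖) 2
      (P.prod angleMeasure) := by
  have hmeas : AEMeasurable (fun p : Ω × ℝ => gaf a ξ p.1 (circleMap 0 r p.2))
      (P.prod angleMeasure) := by
    refine aemeasurable_of_tendsto_metrizable_ae atTop (f := fun N (p : Ω × ℝ) =>
      ∑ n ∈ Finset.range N, ξ n p.1 * (a n : ℂ) * circleMap 0 r p.2 ^ n) (fun N => ?_) ?_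
    · have h1 := hξ.measurable
      have h2 := (continuous_circleMap 0 r).measurable
      fun_prop
    · have h := Measure.quasiMeasurePreserving_fst (μ := P) (ν := angleMeasure) |>.ae
        (hξ.ae_good ha0 ha hne)
      filter_upwards [h] with p hp using hp.tendsto_sum ha0 _
  have hz : ∀ θ, circleMap 0 r θ ≠ 0 := fun θ => by simp [hr.ne']
  have hlog : Measurable fun w : ℂ => Real.log ‖w‖ := by fun_prop
  have hm : AEStronglyMeasurable
      (fun p : Ω × ℝ => Real.log ‖gaf a ξ p.1 (circleMap 0 r p.2)‖) (P.prod angleMeasure) :=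
    (hlog.comp_aemeasurable hmeas).aestronglyMeasurable
  refine (memLp_two_iff_integrable_sq hm).2 ((integrable_prod_iff' (hm.pow 2)).2 ?_)
  refine ⟨ae_of_all _ fun θ => (hξ.memLp_log_norm_gaf ha0 ha hne (hz θ)).integrable_sq, ?_⟩
  have hc : (fun θ => ∫ ω, ‖Real.log ‖gaf a ξ ω (circleMap 0 r θ)‖ ^ 2‖ ∂P) = fun _ =>
      ∫ w, ‖(Real.log (covFun a (r ^ 2)) / 2 + Real.log ‖w‖) ^ 2‖ ∂stdComplexGaussian := by
    ext θ
    rw [hξ.integral_comp_log_norm_gaf ha0 ha hne (hz θ) (φ := fun x => ‖x ^ 2‖) (by fun_prop),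
      norm_circleMap_zero, sq_abs]
  exact hc ▸ integrable_const _

lemma logAverage_eq_integral {Ω : Type*} {ξ : ℕ → Ω → ℂ} (r : ℝ) (ω : Ω) :
    logAverage a ξ r ω = ∫ θ, Real.log ‖gaf a ξ ω (circleMap 0 r θ)‖ ∂angleMeasure :=
  circleAverage_eq_integral_angleMeasure _ _

lemma IsIIDStdComplexGaussian.memLp_logAverage (hξ : IsIIDStdComplexGaussian P ξ)
    (ha0 : ∀ n, 0 ≤ a n) (ha : CovEntire a) (hne : ∃ n, a n ≠ 0) {r : ℝ} (hr : 0 < r) :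
    MemLp (logAverage a ξ r) 2 P := by
  have h := hξ.memLp_log_norm_gaf_prod ha0 ha hne hr
  have hm : AEStronglyMeasurable (logAverage a ξ r) P := by
    rw [funext (logAverage_eq_integral (a := a) (ξ := ξ) r)]
    exact h.1.integral_prod_right'
  rw [memLp_two_iff_integrable_sq hm]
  refine h.integrable_sq.integral_prod_left.mono' (hm.pow 2) ?_
  filter_upwards [h.integrable_sq.prod_right_ae, h.1.prodMk_left] with ω h1 h2
  have h3 := (memLp_two_iff_integrable_sq h2).2 h1
  -- A nonnegative variance in the angle bounds the square of the average by the average of the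
  -- square.
  have h4 := variance_eq_sub h3 ▸ variance_nonneg _ angleMeasure
  rw [logAverage_eq_integral, norm_pow, Real.norm_eq_abs, sq_abs]
  simpa using h4

lemma IsIIDStdComplexGaussian.integral_logAverage (hξ : IsIIDStdComplexGaussian P ξ)
    (ha0 : ∀ n, 0 ≤ a n) (ha : CovEntire a) (hne : ∃ n, a n ≠ 0) {r : ℝ} (hr : 0 < r) :
    ∫ ω, logAverage a ξ r ω ∂P = Real.log (covFun a (r ^ 2)) / 2 + meanLog := by
  have h := (hξ.memLp_log_norm_gaf_prod ha0 ha hne hr).integrable one_le_two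
  simp_rw [logAverage_eq_integral]
  rw [integral_integral_swap h]
  have hz : ∀ θ, circleMap 0 r θ ≠ 0 := fun θ => by simp [hr.ne']
  simp_rw [fun θ => hξ.integral_log_norm_gaf ha0 ha hne (hz θ), norm_circleMap_zero, sq_abs]
  simp

end LogAverage

/-! ### Square integrability and mean of the number of zeros. -/

section ZeroCount

open Real Filter Topology

variable {Ω : Type*} [MeasurableSpace Ω] {P : Measure Ω} [IsProbabilityMeasure P] {a : ℕ → ℝ}
  {ξ : ℕ → Ω → ℂ}

lemma Good.gafZeroCount_mul_le {Ω : Type*} {ξ : ℕ → Ω → ℂ} {ω : Ω} (h : Good a ξ ω)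
    (ha0 : ∀ n, 0 ≤ a n) {r s : ℝ} (hr : 0 < r) (hrs : r ≤ s) :
    gafZeroCount a ξ r ω * (Real.log s - Real.log r) ≤ logAverage a ξ s ω - logAverage a ξ r ω :=
  zeroCount_mul_log_le (h.differentiable ha0) (h.exists_ne_zero ha0) hr hrs

lemma Good.le_gafZeroCount_mul {Ω : Type*} {ξ : ℕ → Ω → ℂ} {ω : Ω} (h : Good a ξ ω)
    (ha0 : ∀ n, 0 ≤ a n) {r s : ℝ} (hr : 0 < r) (hrs : r ≤ s) :
    logAverage a ξ s ω - logAverage a ξ r ω ≤ gafZeroCount a ξ s ω * (Real.log s - Real.log r) :=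
  circleAverage_sub_le_zeroCount_mul_log (h.differentiable ha0) (h.exists_ne_zero ha0) hr hrs

lemma IsIIDStdComplexGaussian.aestronglyMeasurable_gafZeroCount
    (hξ : IsIIDStdComplexGaussian P ξ) (ha0 : ∀ n, 0 ≤ a n) (ha : CovEntire a)
    (hne : ∃ n, a n ≠ 0) {r : ℝ} (hr : 0 < r) :
    AEStronglyMeasurable (gafZeroCount a ξ r) P := by
  obtain ⟨u, -, hu, hlim⟩ := exists_seq_strictAnti_tendsto r
  have hpos : ∀ k, 0 < u k := fun k => hr.trans (hu k)
  refine aestronglyMeasurable_of_tendsto_ae atTop (f := fun k ω =>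
    (logAverage a ξ (u k) ω - logAverage a ξ r ω) * (Real.log (u k) - Real.log r)⁻¹)
    (fun k => ?_) ?_
  · exact ((hξ.memLp_logAverage ha0 ha hne (hpos k)).1.sub
      (hξ.memLp_logAverage ha0 ha hne hr).1).mul_const _
  · filter_upwards [hξ.ae_good ha0 ha hne] with ω hω
    have hlim' : Tendsto u atTop (𝓝[>] r) :=
      tendsto_nhdsWithin_iff.2 ⟨hlim, Eventually.of_forall hu⟩
    have hev := hlim'.eventually
      (zeroCount_eventuallyEq_nhdsGT (hω.differentiable ha0) (hω.exists_ne_zero ha0) r)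
    -- The quotient lies between `n_f(r)` and `n_f(u k)`, which agree for large `k`; the sequence is
    -- eventually constant.
    refine tendsto_const_nhds.congr' ?_
    filter_upwards [hev] with k hk
    have hl : 0 < Real.log (u k) - Real.log r := sub_pos.2 (Real.log_lt_log hr (hu k))
    have h1 := hω.gafZeroCount_mul_le ha0 hr (hu k).le
    have h2 := hω.le_gafZeroCount_mul ha0 hr (hu k).le
    rw [← div_eq_mul_inv, eq_div_iff hl.ne']
    refine le_antisymm h1 (h2.trans_eq ?_)
    rw [gafZeroCount, hk, gafZeroCount]

/-- The number of zeros in a disk is square integrable. -/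
lemma IsIIDStdComplexGaussian.memLp_gafZeroCount (hξ : IsIIDStdComplexGaussian P ξ)
    (ha0 : ∀ n, 0 ≤ a n) (ha : CovEntire a) (hne : ∃ n, a n ≠ 0) {r : ℝ} (hr : 0 < r) :
    MemLp (gafZeroCount a ξ r) 2 P := by
  have hl : 0 < Real.log (2 * r) - Real.log r :=
    sub_pos.2 (Real.log_lt_log hr (by linarith))
  have h := ((hξ.memLp_logAverage ha0 ha hne (by linarith : 0 < 2 * r)).sub
    (hξ.memLp_logAverage ha0 ha hne hr)).mul_const (Real.log (2 * r) - Real.log r)⁻¹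
  refine h.mono (hξ.aestronglyMeasurable_gafZeroCount ha0 ha hne hr) ?_
  filter_upwards [hξ.ae_good ha0 ha hne] with ω hω
  have h1 := hω.gafZeroCount_mul_le ha0 hr (by linarith : r ≤ 2 * r)
  have h0 : 0 ≤ gafZeroCount a ξ r ω := Nat.cast_nonneg _
  rw [Real.norm_of_nonneg h0]
  refine le_trans ?_ (le_abs_self _)
  rw [← div_eq_mul_inv, le_div_iff₀ hl]
  exact h1

lemma sq_eq_exp_two_mul_log {r : ℝ} (hr : 0 < r) : r ^ 2 = Real.exp (2 * Real.log r) := by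
  rw [← Real.log_rpow hr, Real.exp_log (by positivity), Real.rpow_two]

lemma CovEntire.hasDerivAt_log_covFun (ha : CovEntire a) (hne : ∃ n, a n ≠ 0) {r : ℝ}
    (hr : 0 < r) :
    HasDerivAt (fun u => Real.log (covFun a (Real.exp u ^ 2)) / 2) (aFun a (r ^ 2))
      (Real.log r) := by
  have h1 := ha.hasDerivAt_log_momentSeries hne (2 * Real.log r)
  have h2 := (h1.comp (Real.log r) ((hasDerivAt_id (Real.log r)).const_mul 2)).div_const 2
  have he : ∀ u, Real.exp u ^ 2 = Real.exp (2 * u) := fun u => by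
    rw [← Real.exp_nat_mul]; norm_num
  have h3 : logMean a (2 * Real.log r) = aFun a (r ^ 2) := by
    rw [logMean, ← he, Real.exp_log hr]
  simp_rw [he, covFun_exp]
  refine h2.congr_deriv ?_
  rw [h3]
  ring

/-- The Edelman–Kostlan formula: the mean number of zeros in `{|z| ≤ r}` is `a_G(r²)`. -/
lemma IsIIDStdComplexGaussian.integral_gafZeroCount (hξ : IsIIDStdComplexGaussian P ξ)
    (ha0 : ∀ n, 0 ≤ a n) (ha : CovEntire a) (hne : ∃ n, a n ≠ 0) {r : ℝ} (hr : 0 < r) :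
    ∫ ω, gafZeroCount a ξ r ω ∂P = aFun a (r ^ 2) := by
  -- In expectation, Jensen's inequalities put `E n_f(r)` below the right and above the left
  -- difference quotients of `log G(exp (2u)) / 2` at `u = log r`; both tend to `a(r²)`.
  have hslope := hasDerivAt_iff_tendsto_slope.1 (ha.hasDerivAt_log_covFun hne hr)
  have hgt := hslope.mono_left (nhdsWithin_mono (Real.log r)
    (show Set.Ioi (Real.log r) ⊆ {Real.log r}ᶜ from fun x hx => (ne_of_gt hx)))
  have hlt := hslope.mono_left (nhdsWithin_mono (Real.log r)
    (show Set.Iio (Real.log r) ⊆ {Real.log r}ᶜ from fun x hx => (ne_of_lt hx)))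
  have hU : ∀ u, Integrable (logAverage a ξ (Real.exp u)) P := fun u =>
    (hξ.memLp_logAverage ha0 ha hne (Real.exp_pos u)).integrable one_le_two
  have hN := (hξ.memLp_gafZeroCount ha0 ha hne hr).integrable one_le_two
  have hint : ∀ u v, ∫ ω, logAverage a ξ (Real.exp u) ω - logAverage a ξ (Real.exp v) ω ∂P =
      Real.log (covFun a (Real.exp u ^ 2)) / 2 - Real.log (covFun a (Real.exp v ^ 2)) / 2 := by
    intro u v
    rw [integral_sub (hU u) (hU v), hξ.integral_logAverage ha0 ha hne (Real.exp_pos u),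
      hξ.integral_logAverage ha0 ha hne (Real.exp_pos v)]
    ring
  have hlogr : Real.exp (Real.log r) = r := Real.exp_log hr
  refine le_antisymm ?_ ?_
  · refine ge_of_tendsto hgt ?_
    filter_upwards [self_mem_nhdsWithin] with u hu
    have hu : Real.log r < u := hu
    rw [slope_def_field, le_div_iff₀ (sub_pos.2 hu), ← hint, ← integral_mul_const]
    refine integral_mono_ae (hN.mul_const _) ((hU u).sub (hU _)) ?_
    filter_upwards [hξ.ae_good ha0 ha hne] with ω hω
    have := hω.gafZeroCount_mul_le ha0 hr ((Real.log_le_iff_le_exp hr).1 hu.le)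
    rw [Real.log_exp] at this
    rwa [hlogr]
  · refine le_of_tendsto hlt ?_
    filter_upwards [self_mem_nhdsWithin] with u hu
    have hu : u < Real.log r := hu
    rw [slope_comm, slope_def_field, div_le_iff₀ (sub_pos.2 hu), ← hint, ← integral_mul_const]
    refine integral_mono_ae ((hU _).sub (hU _)) (hN.mul_const _) ?_
    filter_upwards [hξ.ae_good ha0 ha hne] with ω hω
    have := hω.le_gafZeroCount_mul ha0 (Real.exp_pos u) ((Real.le_log_iff_exp_le hr).1 hu.le)
    rw [Real.log_exp] at this
    rwa [hlogr]

end ZeroCount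

/-! ### Two general lower bounds for a variance. -/

section Bessel

variable {Ω : Type*} [MeasurableSpace Ω] {P : Measure Ω} [IsProbabilityMeasure P]

/-- Bessel's inequality for a family of pairwise independent variables of the same variance. -/
lemma sum_sq_covariance_le {ι : Type*} {s : Finset ι} {X : Ω → ℝ} {Y : ι → Ω → ℝ} {v : ℝ}
    (hv : 0 < v) (hX : MemLp X 2 P) (hY : ∀ i, MemLp (Y i) 2 P)
    (hind : Pairwise fun i j => IndepFun (Y i) (Y j) P) (hvar : ∀ i, variance (Y i) P = v) :
    ∑ i ∈ s, covariance X (Y i) P ^ 2 ≤ v * variance X P := by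
  -- These are the coefficients of the orthogonal projection; the bound is that the residual has
  -- nonnegative variance.
  set c : ι → ℝ := fun i => covariance X (Y i) P / v with hc
  have hcY : ∀ i, MemLp (fun ω => c i * Y i ω) 2 P := fun i => (hY i).const_mul (c i)
  have h1 : variance (∑ i ∈ s, fun ω => c i * Y i ω) P =
      ∑ i ∈ s, covariance X (Y i) P ^ 2 / v := by
    rw [IndepFun.variance_sum (fun i _ => hcY i)]
    · refine Finset.sum_congr rfl fun i _ => ?_
      rw [variance_const_mul, hvar, hc]
      field_simp
    · intro i _ j _ hij
      exact (hind hij).comp (measurable_const_mul (c i)) (measurable_const_mul (c j))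
  have h2 : covariance X (∑ i ∈ s, fun ω => c i * Y i ω) P =
      ∑ i ∈ s, covariance X (Y i) P ^ 2 / v := by
    rw [covariance_sum_right' (fun i _ => hcY i) hX]
    refine Finset.sum_congr rfl fun i _ => ?_
    rw [covariance_const_mul_right, hc]
    ring
  have h3 := variance_sub hX (memLp_finsetSum' s fun i _ => hcY i)
  have h4 := variance_nonneg (X - ∑ i ∈ s, fun ω => c i * Y i ω) P
  rw [h3, h1, h2, ← Finset.sum_div] at h4
  have h5 : (∑ i ∈ s, covariance X (Y i) P ^ 2) / v ≤ variance X P := by linarith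
  rw [div_le_iff₀ hv] at h5
  linarith

/-- The variance of an integer-valued variable controls the distance of its mean to `ℤ`. -/
lemma fract_mul_le_variance {X : Ω → ℝ} (hX : MemLp X 2 P) (hint : ∀ ω, ∃ n : ℤ, X ω = n) :
    Int.fract (∫ ω, X ω ∂P) * (1 - Int.fract (∫ ω, X ω ∂P)) ≤ variance X P := by
  set μ := ∫ ω, X ω ∂P with hμ
  set k : ℝ := (⌊μ⌋ : ℝ) with hk
  have hf : Int.fract μ = μ - k := rfl
  have hX1 := hX.integrable one_le_two
  have hpt : ∀ ω, (2 * k + 1) * X ω - k * (k + 1) ≤ X ω ^ 2 := by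
    intro ω
    obtain ⟨n, hn⟩ := hint ω
    -- No integer lies strictly between `⌊μ⌋` and `⌊μ⌋ + 1`. Taking expectations of this quadratic
    -- gives the claim.
    have : 0 ≤ (n - ⌊μ⌋) * (n - ⌊μ⌋ - 1) := by
      rcases le_or_gt n ⌊μ⌋ with h | h
      · exact mul_nonneg_of_nonpos_of_nonpos (by linarith) (by linarith)
      · exact mul_nonneg (by linarith) (by linarith [Int.add_one_le_iff.2 h])
    have h2 : (0 : ℝ) ≤ (n - ⌊μ⌋) * (n - ⌊μ⌋ - 1) := by exact_mod_cast this
    rw [hn]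
    nlinarith
  have h1 := integral_mono ((hX1.const_mul (2 * k + 1)).sub (integrable_const (k * (k + 1))))
    hX.integrable_sq hpt
  rw [integral_sub' (hX1.const_mul _) (integrable_const _), integral_const_mul, ← hμ,
    integral_const, probReal_univ, one_smul] at h1
  rw [variance_eq_sub hX, hf]
  have h2 : P[X ^ 2] = ∫ ω, X ω ^ 2 ∂P := rfl
  rw [h2, ← hμ]
  nlinarith

end Bessel

/-! ### Change of measure in one coefficient and the resulting variance bound. -/

section Tilt

open Real Filter Topology
open scoped RealInnerProductSpace

lemma integral_exp_neg_mul_stdComplexGaussian {s : ℝ} (hs : 0 ≤ s) :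
    ∫ z : ℂ, Real.exp (-s * ‖z‖ ^ 2) ∂stdComplexGaussian = (1 + s)⁻¹ := by
  rw [integral_stdComplexGaussian]
  have h := GaussianFourier.integral_rexp_neg_mul_sq_norm (V := ℂ) (b := 1 + s) (by linarith)
  calc ∫ z : ℂ, (Real.pi⁻¹ * Real.exp (-‖z‖ ^ 2)) • Real.exp (-s * ‖z‖ ^ 2)
      = ∫ z : ℂ, Real.pi⁻¹ * Real.exp (-(1 + s) * ‖z‖ ^ 2) := by
        refine integral_congr_ae (ae_of_all _ fun z => ?_)
        simp only [smul_eq_mul]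
        rw [mul_assoc, ← Real.exp_add]
        ring_nf
    _ = _ := by
        rw [integral_const_mul, h]
        have : (1 + s) ≠ 0 := by linarith
        simp [Complex.finrank_real_complex]
        field_simp

/-- The bounded density `2 exp (-|z|²)`, which turns a standard complex Gaussian into one of
variance `1/2`. -/
noncomputable def tilt (z : ℂ) : ℝ := 2 * Real.exp (-‖z‖ ^ 2)

lemma tilt_pos (z : ℂ) : 0 < tilt z := by unfold tilt; positivity

lemma measurable_tilt : Measurable tilt := by unfold tilt; fun_prop

lemma tilt_le (z : ℂ) : tilt z ≤ 2 := by
  have : Real.exp (-‖z‖ ^ 2) ≤ 1 := Real.exp_le_one_iff.2 (by have := sq_nonneg ‖z‖; linarith)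
  unfold tilt
  linarith

lemma integral_tilt : ∫ z, tilt z ∂stdComplexGaussian = 1 := by
  have := integral_exp_neg_mul_stdComplexGaussian (s := 1) zero_le_one
  simp only [tilt]
  rw [integral_const_mul]
  simp only [neg_mul, one_mul] at this
  rw [this]
  norm_num

lemma integral_tilt_sq : ∫ z, tilt z ^ 2 ∂stdComplexGaussian = 4 / 3 := by
  have := integral_exp_neg_mul_stdComplexGaussian (s := 2) zero_le_two
  have h : ∀ z, tilt z ^ 2 = 4 * Real.exp (-2 * ‖z‖ ^ 2) := fun z => by
    rw [tilt, mul_pow, ← Real.exp_nat_mul]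
    push_cast
    ring_nf
  simp_rw [h]
  rw [integral_const_mul, this]
  norm_num

lemma memLp_tilt : MemLp tilt 2 stdComplexGaussian :=
  MemLp.of_bound measurable_tilt.aestronglyMeasurable 2
    (ae_of_all _ fun z => by rw [Real.norm_of_nonneg (tilt_pos z).le]; exact tilt_le z)

lemma lintegral_tilt : ∫⁻ z, ENNReal.ofReal (tilt z) ∂stdComplexGaussian = 1 := by
  rw [← ofReal_integral_eq_lintegral_ofReal (memLp_tilt.integrable one_le_two)
    (ae_of_all _ fun z => (tilt_pos z).le), integral_tilt, ENNReal.ofReal_one]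

lemma map_smul_withDensity_tilt :
    (stdComplexGaussian.withDensity fun z => ENNReal.ofReal (tilt z)).map
      (fun z => Real.sqrt 2 • z) = stdComplexGaussian := by
  have : IsProbabilityMeasure (stdComplexGaussian.withDensity fun z => ENNReal.ofReal (tilt z)) :=
    ⟨by rw [withDensity_apply _ MeasurableSet.univ, Measure.restrict_univ, lintegral_tilt]⟩
  have : IsProbabilityMeasure ((stdComplexGaussian.withDensity fun z =>
      ENNReal.ofReal (tilt z)).map (fun z => Real.sqrt 2 • z)) :=
    Measure.isProbabilityMeasure_map (by fun_prop)
  refine Measure.ext_of_charFun (funext fun t => ?_)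
  rw [charFun_map_smul, charFun_stdComplexGaussian, charFun_apply,
    integral_withDensity_eq_integral_toReal_smul (measurable_tilt.ennreal_ofReal) (by simp),
    integral_stdComplexGaussian]
  have h := GaussianFourier.integral_cexp_neg_mul_sq_norm_add (V := ℂ) (b := 2) (by simp)
    Complex.I (Real.sqrt 2 • t)
  calc ∫ z : ℂ, (Real.pi⁻¹ * Real.exp (-‖z‖ ^ 2)) • (ENNReal.ofReal (tilt z)).toReal •
          Complex.exp (⟪z, Real.sqrt 2 • t⟫ * Complex.I)
      = ∫ z : ℂ, (2 * (Real.pi : ℂ)⁻¹) *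
          Complex.exp (-2 * (‖z‖ : ℂ) ^ 2 + Complex.I * (⟪Real.sqrt 2 • t, z⟫ : ℝ)) := by
        refine integral_congr_ae (ae_of_all _ fun z => ?_)
        simp only [Complex.real_smul]
        rw [ENNReal.toReal_ofReal (tilt_pos z).le, tilt, Complex.exp_add,
          show (-2 * (‖z‖ : ℂ) ^ 2) = -(‖z‖ : ℂ) ^ 2 + -(‖z‖ : ℂ) ^ 2 by ring, Complex.exp_add,
          real_inner_comm]
        push_cast
        ring_nf
    _ = _ := by
        rw [integral_const_mul, h]
        have : (Real.pi : ℂ) ≠ 0 := by exact_mod_cast Real.pi_ne_zero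
        have h2 : ‖Real.sqrt 2 • t‖ ^ 2 = 2 * ‖t‖ ^ 2 := by
          rw [norm_smul, mul_pow, Real.norm_of_nonneg (Real.sqrt_nonneg 2),
            Real.sq_sqrt zero_le_two]
        have h3 : (‖Real.sqrt 2 • t‖ : ℂ) ^ 2 = 2 * (‖t‖ : ℂ) ^ 2 := by exact_mod_cast h2
        rw [h3]
        simp only [Complex.finrank_real_complex, Nat.cast_ofNat, div_self (two_ne_zero' ℂ),
          Complex.cpow_one, Complex.I_sq]
        rw [show 2 * (Real.pi : ℂ)⁻¹ *
          (Real.pi / 2 * Complex.exp (-1 * (2 * (‖t‖ : ℂ) ^ 2) / (4 * 2))) =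
          Complex.exp (-1 * (2 * (‖t‖ : ℂ) ^ 2) / (4 * 2)) by field_simp]
        congr 1
        push_cast
        ring

/-- The dilation factors of the tilted sequence. -/
noncomputable def dilation (m : ℕ) (n : ℕ) : ℝ := if n = m then Real.sqrt 2 else 1

lemma dilation_ne_zero (m n : ℕ) : dilation m n ≠ 0 := by
  unfold dilation
  split_ifs
  · positivity
  · exact one_ne_zero

lemma dilation_pos (m n : ℕ) : 0 < dilation m n := by
  unfold dilation
  split_ifs <;> positivity

lemma dilation_sq (m n : ℕ) : dilation m n ^ 2 = if n = m then 2 else 1 := by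
  unfold dilation
  split_ifs <;> simp

variable {Ω : Type*} [MeasurableSpace Ω] {P : Measure Ω} {a : ℕ → ℝ} {ξ : ℕ → Ω → ℂ}

/-- Under the tilted measure, rescaling `ξ m` gives again an i.i.d. Gaussian sequence. -/
lemma IsIIDStdComplexGaussian.withDensity_tilt [IsProbabilityMeasure P]
    (hξ : IsIIDStdComplexGaussian P ξ) (m : ℕ) :
    IsIIDStdComplexGaussian (P.withDensity fun ω => ENNReal.ofReal (tilt (ξ m ω)))
      (fun n ω => dilation m n • ξ n ω) := by
  set Q := P.withDensity fun ω => ENNReal.ofReal (tilt (ξ m ω)) with hQ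
  have hmeas : ∀ n, Measurable fun ω => dilation m n • ξ n ω := fun n =>
    (measurable_const_smul (dilation m n)).comp (hξ.measurable n)
  -- With `m ∈ S` the density is absorbed into the factor of index `m` and the integral factorizes.
  -- Any other `S` is enlarged by `m` with the trivial event.
  have key : ∀ (S : Finset ℕ) (A : ℕ → Set ℂ), (∀ i, MeasurableSet (A i)) → m ∈ S →
      Q (⋂ i ∈ S, (fun ω => dilation m i • ξ i ω) ⁻¹' A i) =
        ∏ i ∈ S, stdComplexGaussian (A i) := by
    intro S A hA hm
    set u : ℕ → ℂ → ENNReal := fun i w =>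
      (A i).indicator (fun _ => (1 : ENNReal)) (dilation m i • w) *
        (if i = m then ENNReal.ofReal (tilt w) else 1) with hu
    have hum : ∀ i, Measurable (u i) := by
      intro i
      refine Measurable.mul ?_ ?_
      · exact (measurable_const.indicator (hA i)).comp (measurable_const_smul _)
      · split_ifs
        · exact measurable_tilt.ennreal_ofReal
        · exact measurable_const
    have hB : MeasurableSet (⋂ i ∈ S, (fun ω => dilation m i • ξ i ω) ⁻¹' A i) :=
      Finset.measurableSet_biInter S fun i _ => hmeas i (hA i)
    have h1 : Q (⋂ i ∈ S, (fun ω => dilation m i • ξ i ω) ⁻¹' A i) =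
        ∫⁻ ω, ∏ i ∈ S, u i (ξ i ω) ∂P := by
      rw [hQ, withDensity_apply _ hB, ← lintegral_indicator hB]
      refine lintegral_congr fun ω => ?_
      rw [Finset.prod_mul_distrib, Finset.prod_ite_eq' S m, if_pos hm]
      by_cases hω : ω ∈ ⋂ i ∈ S, (fun ω => dilation m i • ξ i ω) ⁻¹' A i
      · rw [Set.indicator_of_mem hω, Finset.prod_eq_one, one_mul]
        intro i hi
        rw [Set.indicator_of_mem]
        exact Set.mem_iInter₂.1 hω i hi
      · rw [Set.indicator_of_notMem hω]
        simp only [Set.mem_iInter, not_forall] at hω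
        obtain ⟨i, hi, hω⟩ := hω
        rw [Finset.prod_eq_zero hi, zero_mul]
        rw [Set.indicator_of_notMem]
        exact hω
    rw [h1, lintegral_prod_eq_prod_lintegral_of_indepFun S (fun i ω => u i (ξ i ω))
      (hξ.indep.comp u hum) (fun i => (hum i).comp (hξ.measurable i))]
    refine Finset.prod_congr rfl fun i _ => ?_
    rw [← lintegral_map (hum i) (hξ.measurable i), hξ.law i]
    by_cases hi : i = m
    · simp only [hu, hi, if_true, dilation]
      nth_rewrite 2 [← map_smul_withDensity_tilt]
      have hA' : MeasurableSet ((fun z : ℂ => Real.sqrt 2 • z) ⁻¹' A m) :=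
        (measurable_const_smul _) (hA m)
      rw [Measure.map_apply (by fun_prop) (hA m), withDensity_apply _ hA',
        ← lintegral_indicator hA']
      refine lintegral_congr fun w => ?_
      by_cases hw : Real.sqrt 2 • w ∈ A m
      · rw [Set.indicator_of_mem hw, Set.indicator_of_mem (by exact hw), one_mul]
      · rw [Set.indicator_of_notMem hw, Set.indicator_of_notMem (by exact hw), zero_mul]
    · simp only [hu, hi, if_false, dilation, one_smul, mul_one]
      rw [lintegral_indicator_const (hA i), one_mul]
  have key' : ∀ (S : Finset ℕ) (A : ℕ → Set ℂ), (∀ i ∈ S, MeasurableSet (A i)) →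
      Q (⋂ i ∈ S, (fun ω => dilation m i • ξ i ω) ⁻¹' A i) =
        ∏ i ∈ S, stdComplexGaussian (A i) := by
    intro S A hA
    classical
    have h := key (insert m S) (fun i => if i ∈ S then A i else Set.univ) (fun i => by
      split_ifs with hi
      · exact hA i hi
      · exact MeasurableSet.univ) (Finset.mem_insert_self m S)
    have e1 : (⋂ i ∈ insert m S, (fun ω => dilation m i • ξ i ω) ⁻¹'
        (if i ∈ S then A i else Set.univ)) =
        ⋂ i ∈ S, (fun ω => dilation m i • ξ i ω) ⁻¹' A i := by
      ext ω
      simp only [Set.mem_iInter, Set.mem_preimage]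
      refine ⟨fun h i hi => by simpa [hi] using h i (Finset.mem_insert_of_mem hi),
        fun h i _ => ?_⟩
      by_cases hi : i ∈ S
      · simpa [hi] using h i hi
      · simp [hi]
    rw [e1] at h
    rw [h]
    refine (Finset.prod_subset (Finset.subset_insert m S) fun i _ hi => ?_).symm.trans
      (Finset.prod_congr rfl fun i hi => ?_)
    · simp [hi]
    · simp [hi]
  have hlaw : ∀ n (A : Set ℂ), MeasurableSet A →
      Q ((fun ω => dilation m n • ξ n ω) ⁻¹' A) = stdComplexGaussian A := by
    intro n A hA
    simpa using key' {n} (fun _ => A) (fun _ _ => hA)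
  refine ⟨hmeas, fun n => Measure.ext fun A hA => ?_, ?_⟩
  · rw [Measure.map_apply (hmeas n) hA, hlaw n A hA]
  · rw [iIndepFun_iff_measure_inter_preimage_eq_mul]
    intro S A hA
    rw [key' S A hA]
    exact Finset.prod_congr rfl fun i hi => (hlaw i _ (hA i hi)).symm

lemma gaf_dilation {Ω : Type*} {ξ : ℕ → Ω → ℂ} (m : ℕ) (ω : Ω) :
    gaf (fun n => a n / dilation m n) (fun n ω => dilation m n • ξ n ω) ω = gaf a ξ ω := by
  funext z
  refine tsum_congr fun n => ?_
  have : (dilation m n : ℂ) ≠ 0 := by exact_mod_cast dilation_ne_zero m n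
  simp only [Complex.real_smul]
  push_cast
  field_simp

lemma dilation_sq_div (m n : ℕ) : (a n / dilation m n) ^ 2 =
    a n ^ 2 - if n = m then a m ^ 2 / 2 else 0 := by
  rw [div_pow, dilation_sq]
  split_ifs with h
  · subst h; ring
  · ring

lemma CovEntire.div_dilation (ha : CovEntire a) (m : ℕ) :
    CovEntire (fun n => a n / dilation m n) := by
  intro x
  refine Summable.of_norm_bounded (ha |x|) fun n => ?_
  rw [norm_mul, norm_pow, norm_pow, Real.norm_eq_abs x]
  refine mul_le_mul_of_nonneg_right ?_ (by positivity)
  rw [← norm_pow, Real.norm_of_nonneg (sq_nonneg _), dilation_sq_div]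
  have : (0 : ℝ) ≤ if n = m then a m ^ 2 / 2 else 0 := by split_ifs <;> positivity
  linarith

lemma CovEntire.momentSeries_div_dilation (ha : CovEntire a) (m k : ℕ) (t : ℝ) :
    momentSeries (fun n => a n / dilation m n) k t =
      momentSeries a k t - (m : ℝ) ^ k * (a m ^ 2 * Real.exp (m * t)) / 2 := by
  have h1 := (ha.summable_moment k t).hasSum
  have h2 := hasSum_ite_eq m ((m : ℝ) ^ k * (a m ^ 2 * Real.exp (m * t)) / 2)
  rw [momentSeries, momentSeries, ← (h1.sub h2).tsum_eq]
  refine tsum_congr fun n => ?_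
  rw [dilation_sq_div]
  split_ifs with h
  · subst h; ring
  · ring

lemma CovEntire.weight_le_one (ha : CovEntire a) (hne : ∃ n, a n ≠ 0) (t : ℝ) (m : ℕ) :
    weight a t m ≤ 1 := by
  have h := ha.hasSum_weight hne t
  rw [← h.tsum_eq]
  exact h.summable.le_tsum m fun n _ => ha.weight_nonneg hne t n

lemma CovEntire.logMean_div_dilation_sub (ha : CovEntire a) (hne : ∃ n, a n ≠ 0) (m : ℕ) (t : ℝ) :
    logMean (fun n => a n / dilation m n) t - logMean a t =
      -((m - logMean a t) * weight a t m) / (2 - weight a t m) := by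
  rw [(ha.div_dilation m).logMean_eq, ha.momentSeries_div_dilation, ha.momentSeries_div_dilation]
  have h0 := ha.momentSeries_pos hne t
  have hw : a m ^ 2 * Real.exp (m * t) = weight a t m * momentSeries a 0 t := by
    rw [weight]; field_simp
  have h1 : momentSeries a 1 t = logMean a t * momentSeries a 0 t := by
    rw [ha.logMean_eq]; field_simp
  have h2 := ha.weight_le_one hne t m
  have h3 : 2 - weight a t m ≠ 0 := by linarith
  rw [hw, h1]
  have h4 : momentSeries a 0 t - (m : ℝ) ^ 0 * (weight a t m * momentSeries a 0 t) / 2 =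
      momentSeries a 0 t * (2 - weight a t m) / 2 := by ring
  rw [h4]
  field_simp
  ring

variable [IsProbabilityMeasure P]

/-- The covariance of the number of zeros with the tilting density of one coefficient. -/
lemma IsIIDStdComplexGaussian.covariance_gafZeroCount_tilt (hξ : IsIIDStdComplexGaussian P ξ)
    (ha0 : ∀ n, 0 ≤ a n) (ha : CovEntire a) (hne : ∃ n, a n ≠ 0) {r : ℝ} (hr : 0 < r) (m : ℕ) :
    covariance (gafZeroCount a ξ r) (fun ω => tilt (ξ m ω)) P =
      aFun (fun n => a n / dilation m n) (r ^ 2) - aFun a (r ^ 2) := by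
  have hρ : Measurable fun ω => tilt (ξ m ω) := measurable_tilt.comp (hξ.measurable m)
  have hmem : MemLp (fun ω => tilt (ξ m ω)) 2 P :=
    MemLp.of_bound hρ.aestronglyMeasurable 2
      (ae_of_all _ fun ω => by rw [Real.norm_of_nonneg (tilt_pos _).le]; exact tilt_le _)
  have hmean : ∫ ω, tilt (ξ m ω) ∂P = 1 := by
    rw [← integral_map (f := tilt) (hξ.measurable m).aemeasurable
      measurable_tilt.aestronglyMeasurable, hξ.law m, integral_tilt]
  set Q := P.withDensity fun ω => ENNReal.ofReal (tilt (ξ m ω)) with hQ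
  have hQprob : IsProbabilityMeasure Q := ⟨by
    rw [hQ, withDensity_apply _ MeasurableSet.univ, Measure.restrict_univ,
      ← lintegral_map (f := fun z => ENNReal.ofReal (tilt z)) measurable_tilt.ennreal_ofReal
        (hξ.measurable m), hξ.law m, lintegral_tilt]⟩
  obtain ⟨n, hn⟩ := hne
  -- The same function `f` is, under the tilted measure, the Gaussian series with `a_m` divided by
  -- `√2`, so Edelman–Kostlan computes the tilted mean of its zero count.
  have hEK := (hξ.withDensity_tilt m).integral_gafZeroCount
    (fun n => div_nonneg (ha0 n) (dilation_pos m n).le) (ha.div_dilation m)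
    ⟨n, div_ne_zero hn (dilation_ne_zero m n)⟩ hr
  have hsame : gafZeroCount (fun n => a n / dilation m n) (fun n ω => dilation m n • ξ n ω) r =
      gafZeroCount a ξ r := by
    funext ω
    rw [gafZeroCount, gafZeroCount, gaf_dilation]
  rw [hsame, integral_withDensity_eq_integral_toReal_smul hρ.ennreal_ofReal (by simp)] at hEK
  rw [covariance_eq_sub (hξ.memLp_gafZeroCount ha0 ha ⟨n, hn⟩ hr) hmem, hmean, mul_one,
    hξ.integral_gafZeroCount ha0 ha ⟨n, hn⟩ hr, ← hEK]
  congr 1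
  refine integral_congr_ae (ae_of_all _ fun ω => ?_)
  simp only [Pi.mul_apply, smul_eq_mul]
  rw [ENNReal.toReal_ofReal (tilt_pos _).le, mul_comm]

/-- A lower bound for the variance of the number of zeros by the first chaos. -/
lemma IsIIDStdComplexGaussian.sum_sq_le_variance (hξ : IsIIDStdComplexGaussian P ξ)
    (ha0 : ∀ n, 0 ≤ a n) (ha : CovEntire a) (hne : ∃ n, a n ≠ 0) {r : ℝ} (hr : 0 < r)
    (s : Finset ℕ) :
    ∑ m ∈ s, (((m : ℝ) - logMean a (2 * Real.log r)) * weight a (2 * Real.log r) m) ^ 2 ≤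
      4 / 3 * variance (gafZeroCount a ξ r) P := by
  have hm : ∀ m, Measurable fun ω => tilt (ξ m ω) := fun m => measurable_tilt.comp (hξ.measurable m)
  have hmem : ∀ m, MemLp (fun ω => tilt (ξ m ω)) 2 P := fun m =>
    MemLp.of_bound (hm m).aestronglyMeasurable 2
      (ae_of_all _ fun ω => by rw [Real.norm_of_nonneg (tilt_pos _).le]; exact tilt_le _)
  have hvar : ∀ m, variance (fun ω => tilt (ξ m ω)) P = 1 / 3 := by
    intro m
    have h1 := variance_map (X := tilt) (Y := ξ m) (μ := P)
      measurable_tilt.aemeasurable (hξ.measurable m).aemeasurable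
    rw [hξ.law m] at h1
    change variance (tilt ∘ ξ m) P = _
    rw [← h1, variance_eq_sub memLp_tilt, integral_tilt]
    have : ∫ z, (tilt ^ 2) z ∂stdComplexGaussian = 4 / 3 := integral_tilt_sq
    rw [this]
    norm_num
  have hB := sum_sq_covariance_le (s := s) (v := 1 / 3) (by norm_num)
    (hξ.memLp_gafZeroCount ha0 ha hne hr) hmem
    (fun i j hij => (hξ.indep.indepFun hij).comp measurable_tilt measurable_tilt) hvar
  have hpt : ∀ m : ℕ,
      (((m : ℝ) - logMean a (2 * Real.log r)) * weight a (2 * Real.log r) m) ^ 2 ≤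
        4 * covariance (gafZeroCount a ξ r) (fun ω => tilt (ξ m ω)) P ^ 2 := by
    intro m
    rw [hξ.covariance_gafZeroCount_tilt ha0 ha hne hr m,
      sq_eq_exp_two_mul_log hr]
    change _ ≤ 4 * (logMean (fun n => a n / dilation m n) (2 * Real.log r) -
      logMean a (2 * Real.log r)) ^ 2
    rw [ha.logMean_div_dilation_sub hne, div_pow, neg_sq]
    have h0 := ha.weight_nonneg hne (2 * Real.log r) m
    have h1 := ha.weight_le_one hne (2 * Real.log r) m
    -- As `0 ≤ w_m ≤ 1`, the denominator `(2 - w_m)²` is positive and at most `4`.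
    rw [← mul_div_assoc, le_div_iff₀ (by nlinarith), mul_comm (4 : ℝ)]
    refine mul_le_mul_of_nonneg_left ?_ (sq_nonneg _)
    nlinarith
  calc _ ≤ ∑ m ∈ s, 4 * covariance (gafZeroCount a ξ r) (fun ω => tilt (ξ m ω)) P ^ 2 :=
        Finset.sum_le_sum fun m _ => hpt m
    _ ≤ _ := by
        rw [← Finset.mul_sum]
        linarith

lemma IsIIDStdComplexGaussian.fract_le_variance (hξ : IsIIDStdComplexGaussian P ξ)
    (ha0 : ∀ n, 0 ≤ a n) (ha : CovEntire a) (hne : ∃ n, a n ≠ 0) {r : ℝ} (hr : 0 < r) :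
    Int.fract (aFun a (r ^ 2)) * (1 - Int.fract (aFun a (r ^ 2))) ≤
      variance (gafZeroCount a ξ r) P := by
  rw [← hξ.integral_gafZeroCount ha0 ha hne hr]
  exact fract_mul_le_variance (hξ.memLp_gafZeroCount ha0 ha hne hr)
    fun ω => ⟨(zeroCount (gaf a ξ ω) r : ℤ), by simp [gafZeroCount]⟩

end Tilt

/-! ### Exceptional sets of finite length in `t`, and the bounds that hold outside them. -/

section ExceptionalSets

open Real Filter Topology

/-- A monotone function rarely crosses one of countably many levels within a summable sequence of
times. -/
lemma exists_finite_measure_levels {m : ℝ → ℝ} (hm : Monotone m) (L : ℕ → ℝ) {δ : ℕ → ℝ}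
    (hδ : Summable δ) :
    ∃ F : Set ℝ, MeasurableSet F ∧ volume F < ⊤ ∧ ∀ t, t ∉ F → ∀ j, L j ≤ m t → m t < L (j + 1) →
      m (t + δ j) < L (j + 1) ∧ L j ≤ m (t - δ j) := by
  set U : ℕ → Set ℝ := fun j => {t | m t < L (j + 1) ∧ L (j + 1) ≤ m (t + δ j)} with hU
  set V : ℕ → Set ℝ := fun j => {t | m (t - δ j) < L j ∧ L j ≤ m t} with hV
  have hmm := hm.measurable
  have hUm : ∀ j, MeasurableSet (U j) := fun j =>
    (measurableSet_lt hmm measurable_const).inter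
      (measurableSet_le measurable_const (hmm.comp (measurable_add_const _)))
  have hVm : ∀ j, MeasurableSet (V j) := fun j =>
    (measurableSet_lt (hmm.comp (measurable_sub_const _)) measurable_const).inter
      (measurableSet_le measurable_const hmm)
  have hdiam : ∀ (s : Set ℝ) (d : ℝ), (∀ x ∈ s, ∀ y ∈ s, x ≤ y → y ≤ x + d) →
      volume s ≤ ENNReal.ofReal d := by
    intro s d h
    refine (Real.volume_le_diam s).trans (Metric.ediam_le fun x hx y hy => ?_)
    rw [edist_dist, Real.dist_eq]
    refine ENNReal.ofReal_le_ofReal ?_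
    rcases le_total x y with hxy | hxy
    · rw [abs_sub_comm, abs_of_nonneg (by linarith)]
      linarith [h x hx y hy hxy]
    · rw [abs_of_nonneg (by linarith)]
      linarith [h y hy x hx hxy]
  -- By monotonicity each level is crossed once, so the times within `δ j` of the crossing on one
  -- side have diameter at most `δ j`.
  have hUv : ∀ j, volume (U j) ≤ ENNReal.ofReal (δ j) := fun j => hdiam _ _ fun x hx y hy _ => by
    by_contra! hlt
    exact absurd ((hx.2.trans (hm hlt.le)).trans_lt hy.1) (lt_irrefl _)
  have hVv : ∀ j, volume (V j) ≤ ENNReal.ofReal (δ j) := fun j => hdiam _ _ fun x hx y hy _ => by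
    by_contra! hlt
    exact absurd ((hx.2.trans (hm (by linarith : x ≤ y - δ j))).trans_lt hy.1) (lt_irrefl _)
  have hfin : ∑' j, ENNReal.ofReal (δ j) < ⊤ := lt_top_iff_ne_top.2 hδ.tsum_ofReal_ne_top
  refine ⟨(⋃ j, U j) ∪ ⋃ j, V j, (MeasurableSet.iUnion hUm).union (MeasurableSet.iUnion hVm), ?_,
    fun t ht j h1 h2 => ?_⟩
  · refine (measure_union_le _ _).trans_lt (ENNReal.add_lt_top.2 ⟨?_, ?_⟩)
    · exact (measure_iUnion_le _).trans_lt ((ENNReal.tsum_le_tsum hUv).trans_lt hfin)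
    · exact (measure_iUnion_le _).trans_lt ((ENNReal.tsum_le_tsum hVv).trans_lt hfin)
  · simp only [Set.mem_union, Set.mem_iUnion, not_or, not_exists] at ht
    refine ⟨?_, ?_⟩
    · by_contra! h
      exact ht.1 j ⟨h2, h⟩
    · by_contra! h
      exact ht.2 j ⟨h, h1⟩

lemma finiteLogMeasure_of_volume {F : Set ℝ} (hF : MeasurableSet F) (hv : volume F < ⊤) :
    FiniteLogMeasure {r : ℝ | 0 < r ∧ 2 * Real.log r ∈ F} := by
  have hE : MeasurableSet {r : ℝ | 0 < r ∧ 2 * Real.log r ∈ F} :=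
    measurableSet_Ioi.inter ((measurable_const.mul Real.measurable_log) hF)
  refine ⟨hE, fun r hr => hr.1, ?_⟩
  have h := lintegral_image_eq_lintegral_abs_deriv_mul (f := fun r => 2 * Real.log r)
    (f' := fun r => 2 * r⁻¹) hE
    (fun r hr => ((Real.hasDerivAt_log hr.1.ne').const_mul 2).hasDerivWithinAt)
    (fun r hr s hs hrs => Real.log_injOn_pos hr.1 hs.1 (by simpa using hrs)) (fun _ => 1)
  simp only [mul_one, lintegral_const, one_mul, Measure.restrict_apply MeasurableSet.univ,
    Set.univ_inter] at h
  refine lt_of_le_of_lt ?_ (lt_of_le_of_lt (measure_mono (s := (fun r => 2 * Real.log r) ''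
    {r : ℝ | 0 < r ∧ 2 * Real.log r ∈ F}) ?_) hv)
  · rw [h]
    refine setLIntegral_mono' hE fun r hr => ENNReal.ofReal_le_ofReal ?_
    have : 0 < r⁻¹ := inv_pos.2 hr.1
    rw [one_div]
    refine le_trans ?_ (le_abs_self _)
    linarith
  · rintro _ ⟨r, hr, rfl⟩
    exact hr.2

/-- The distance of `u` to the integers, up to a factor. -/
noncomputable def fractProd (u : ℝ) : ℝ := Int.fract u * (1 - Int.fract u)

lemma fractProd_nonneg (u : ℝ) : 0 ≤ fractProd u :=
  mul_nonneg (Int.fract_nonneg u) (by linarith [Int.fract_lt_one u])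

lemma measurable_fractProd : Measurable fractProd :=
  measurable_fract.mul (measurable_const.sub measurable_fract)

lemma lintegral_unit_rpow_lt_top :
    ∫⁻ v, (Set.Ioo (0 : ℝ) 1).indicator
      (fun v => ENNReal.ofReal ((v * (1 - v)) ^ (-(3 / 4) : ℝ))) v < ⊤ := by
  have h := (Complex.betaIntegral_convergent (u := 1 / 4) (v := 1 / 4) (by norm_num)
    (by norm_num)).norm
  rw [intervalIntegrable_iff_integrableOn_Ioo_of_le zero_le_one] at h
  rw [lintegral_indicator measurableSet_Ioo]
  have h2 := h.2
  rw [HasFiniteIntegral] at h2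
  refine lt_of_le_of_lt (setLIntegral_mono' measurableSet_Ioo fun v hv => ?_) h2
  rw [Real.enorm_eq_ofReal (norm_nonneg _)]
  refine ENNReal.ofReal_le_ofReal (le_of_eq ?_)
  have h1 : 0 < 1 - v := by linarith [hv.2]
  rw [norm_mul, Complex.norm_cpow_eq_rpow_re_of_pos hv.1,
    show (1 - (v : ℂ)) = ((1 - v : ℝ) : ℂ) by push_cast; ring,
    Complex.norm_cpow_eq_rpow_re_of_pos h1, Real.mul_rpow hv.1.le h1.le]
  norm_num

/-- On each unit interval the fractional part contributes the convergent Beta integral `B(1/4,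
1/4)`, and `∑ n^(-9/8)` converges. -/
lemma lintegral_fractProd_rpow_lt_top :
    ∫⁻ u in Set.Ici (1 : ℝ), ENNReal.ofReal (fractProd u ^ (-(3 / 4) : ℝ) * u ^ (-(9 / 8) : ℝ))
      < ⊤ := by
  set H : ℝ → ENNReal := (Set.Ioo (0 : ℝ) 1).indicator
    (fun v => ENNReal.ofReal ((v * (1 - v)) ^ (-(3 / 4) : ℝ))) with hH
  have hHm : Measurable H := by
    refine Measurable.indicator ?_ measurableSet_Ioo
    fun_prop
  have hpt : ∀ u ∈ Set.Ici (1 : ℝ),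
      ENNReal.ofReal (fractProd u ^ (-(3 / 4) : ℝ) * u ^ (-(9 / 8) : ℝ)) ≤
        ∑' n : ℕ, ENNReal.ofReal ((n : ℝ) ^ (-(9 / 8) : ℝ)) * H (u - n) := by
    intro u hu
    have hu1 : (1 : ℝ) ≤ u := hu
    have hu0 : 0 ≤ u := by linarith
    have hfl : u - ⌊u⌋₊ = Int.fract u := by
      rw [← Int.self_sub_floor, natCast_floor_eq_intCast_floor hu0]
    refine le_trans ?_ (ENNReal.le_tsum ⌊u⌋₊)
    rw [hfl]
    rcases (Int.fract_nonneg u).eq_or_lt with h0 | h0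
    -- At integers `Real.rpow` gives `0 ^ (-3/4) = 0`, so the integrand vanishes there.
    · rw [fractProd, ← h0, zero_mul, Real.zero_rpow (by norm_num), zero_mul, ENNReal.ofReal_zero]
      exact zero_le
    · have hmem : Int.fract u ∈ Set.Ioo (0 : ℝ) 1 := ⟨h0, Int.fract_lt_one u⟩
      rw [hH, Set.indicator_of_mem hmem, ← ENNReal.ofReal_mul (by positivity),
        mul_comm]
      refine ENNReal.ofReal_le_ofReal ?_
      refine mul_le_mul_of_nonneg_right ?_ (Real.rpow_nonneg (fractProd_nonneg u) _)
      refine Real.rpow_le_rpow_of_nonpos ?_ (Nat.floor_le hu0) (by norm_num)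
      exact_mod_cast Nat.floor_pos.2 hu1
  refine lt_of_le_of_lt (setLIntegral_mono' measurableSet_Ici hpt) ?_
  refine lt_of_le_of_lt (setLIntegral_le_lintegral _ _) ?_
  have hHn : ∀ n : ℕ, Measurable fun u => H (u - n) := fun n => hHm.comp (measurable_sub_const _)
  rw [lintegral_tsum fun n => ((hHn n).const_mul _).aemeasurable]
  have h1 : ∀ n : ℕ, ∫⁻ u, ENNReal.ofReal ((n : ℝ) ^ (-(9 / 8) : ℝ)) * H (u - n) =
      ENNReal.ofReal ((n : ℝ) ^ (-(9 / 8) : ℝ)) * ∫⁻ u, H u := fun n => by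
    rw [lintegral_const_mul _ (hHn n),
      lintegral_sub_right_eq_self H (n : ℝ)]
  simp_rw [h1]
  rw [ENNReal.tsum_mul_right]
  exact ENNReal.mul_lt_top
    (lt_top_iff_ne_top.2 (Real.summable_nat_rpow.2 (by norm_num)).tsum_ofReal_ne_top)
    lintegral_unit_rpow_lt_top

variable {a : ℕ → ℝ}

lemma CovEntire.measurable_logVar (ha : CovEntire a) (hne : ∃ n, a n ≠ 0) :
    Measurable (logVar a) := by
  have : logVar a = deriv (logMean a) := funext fun t => (ha.hasDerivAt_logMean hne t).deriv.symm
  rw [this]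
  exact measurable_deriv _

/-- Where the variance of the weights is small, their mean is rarely close to an integer. -/
lemma CovEntire.exists_finite_measure_fract (ha : CovEntire a)
    (hinf : {n : ℕ | a n ≠ 0}.Infinite) :
    ∃ F : Set ℝ, MeasurableSet F ∧ volume F < ⊤ ∧ ∀ t, t ∉ F → 1 ≤ logMean a t → logVar a t ≤ 1 →
      logVar a t ^ 2 ≤ logMean a t ^ (3 / 2 : ℝ) * fractProd (logMean a t) := by
  have hne := hinf.nonempty
  have hα := (ha.continuous_logMean hne).measurable
  have hβ := ha.measurable_logVar hne
  have hinj := (ha.strictMono_logMean hinf).injective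
  set F : Set ℝ := {t | 1 ≤ logMean a t ∧ logVar a t ≤ 1 ∧
    logMean a t ^ (3 / 2 : ℝ) * fractProd (logMean a t) < logVar a t ^ 2} with hF
  have hFm : MeasurableSet F :=
    (measurableSet_le measurable_const hα).inter ((measurableSet_le hβ measurable_const).inter
      (measurableSet_lt ((hα.pow_const _).mul (measurable_fractProd.comp hα)) (hβ.pow_const 2)))
  -- Discarding the countably many times where the mean is an integer makes `fractProd` positive.
  set Z : Set ℝ := logMean a ⁻¹' Set.range ((↑) : ℤ → ℝ) with hZ
  have hZc : Z.Countable := (Set.countable_range _).preimage hinj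
  refine ⟨F, hFm, ?_, fun t ht h1 h2 => ?_⟩
  · have hd : volume F ≤ volume (F \ Z) := by
      rw [measure_sdiff_null (hZc.measure_zero _)]
    refine hd.trans_lt ?_
    have hFZm : MeasurableSet (F \ Z) := hFm.diff hZc.measurableSet
    have hcv := lintegral_image_eq_lintegral_abs_deriv_mul hFZm
      (fun t _ => (ha.hasDerivAt_logMean hne t).hasDerivWithinAt) hinj.injOn
      (fun u => ENNReal.ofReal (fractProd u ^ (-(3 / 4) : ℝ) * u ^ (-(9 / 8) : ℝ)))
    calc volume (F \ Z) = ∫⁻ t in F \ Z, 1 := by simp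
      _ ≤ ∫⁻ t in F \ Z, ENNReal.ofReal |logVar a t| * ENNReal.ofReal
          (fractProd (logMean a t) ^ (-(3 / 4) : ℝ) * logMean a t ^ (-(9 / 8) : ℝ)) := by
        refine setLIntegral_mono' hFZm fun t ht => ?_
        obtain ⟨⟨h1, h2, h3⟩, h4⟩ := ht
        have hb := ha.logVar_pos hinf t
        have hα0 : 0 < logMean a t := by linarith
        have hfr : 0 < Int.fract (logMean a t) := by
          refine lt_of_le_of_ne (Int.fract_nonneg _) fun h => h4 ?_
          exact ⟨⌊logMean a t⌋, by rw [← Int.self_sub_floor] at h; linarith⟩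
        have hψ : 0 < fractProd (logMean a t) :=
          mul_pos hfr (by linarith [Int.fract_lt_one (logMean a t)])
        rw [← ENNReal.ofReal_mul (abs_nonneg _), abs_of_pos hb, ← ENNReal.ofReal_one]
        refine ENNReal.ofReal_le_ofReal ?_
        -- The reverse inequality defining `F`, raised to the power `3/4`, together with `β^(3/2) ≤
        -- β` for `β ≤ 1`. Hence `1 ≤ β ψ(α)^(-3/4) α^(-9/8)` on `F`, with `ψ` for `fractProd`, and
        -- `β dt = dα`.
        have h5 : logMean a t ^ (9 / 8 : ℝ) * fractProd (logMean a t) ^ (3 / 4 : ℝ) ≤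
            logVar a t := by
          calc logMean a t ^ (9 / 8 : ℝ) * fractProd (logMean a t) ^ (3 / 4 : ℝ)
              = (logMean a t ^ (3 / 2 : ℝ) * fractProd (logMean a t)) ^ (3 / 4 : ℝ) := by
                rw [Real.mul_rpow (by positivity) hψ.le, ← Real.rpow_mul hα0.le]
                norm_num
            _ ≤ (logVar a t ^ 2) ^ (3 / 4 : ℝ) :=
                Real.rpow_le_rpow (by positivity) h3.le (by norm_num)
            _ = logVar a t ^ (3 / 2 : ℝ) := by
                rw [← Real.rpow_natCast, ← Real.rpow_mul hb.le]
                norm_num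
            _ ≤ logVar a t ^ (1 : ℝ) :=
                Real.rpow_le_rpow_of_exponent_ge hb h2 (by norm_num)
            _ = logVar a t := Real.rpow_one _
        rw [Real.rpow_neg hψ.le, Real.rpow_neg hα0.le, ← mul_inv, ← div_eq_mul_inv,
          le_div_iff₀ (by positivity), one_mul, mul_comm]
        exact h5
      _ = _ := hcv.symm
      _ ≤ _ := lintegral_mono_set (by
        rintro _ ⟨t, ht, rfl⟩
        exact ht.1.1)
      _ < ⊤ := lintegral_fractProd_rpow_lt_top
  · by_contra! h
    exact ht ⟨h1, h2, h⟩

/-- Bernoulli's inequality for `(1 - 1/(x + 1))^p`, then `x + 1 ≤ 2x`. -/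
lemma rpow_add_one_sub_rpow_le {p x : ℝ} (hp : 1 ≤ p) (hx : 1 ≤ x) :
    (x + 1) ^ p - x ^ p ≤ p * 2 ^ (p - 1) * x ^ (p - 1) := by
  have hx1 : 0 < x + 1 := by linarith
  have h := one_add_mul_self_le_rpow_one_add (s := -(x + 1)⁻¹)
    (by have := inv_le_one_of_one_le₀ (by linarith : (1 : ℝ) ≤ x + 1); linarith) hp
  have h1 : (1 + -(x + 1)⁻¹) = x / (x + 1) := by field_simp; ring
  rw [h1, Real.div_rpow (by linarith) hx1.le, le_div_iff₀ (by positivity)] at h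
  have h2 : (x + 1) ^ p = (x + 1) ^ (p - 1) * (x + 1) := by
    rw [← Real.rpow_add_one hx1.ne']; ring_nf
  have h3 : (x + 1) ^ (p - 1) ≤ 2 ^ (p - 1) * x ^ (p - 1) := by
    rw [← Real.mul_rpow zero_le_two (by linarith)]
    exact Real.rpow_le_rpow hx1.le (by linarith) (by linarith)
  have h4 : (1 + p * -(x + 1)⁻¹) * (x + 1) ^ p = (x + 1) ^ p - p * (x + 1) ^ (p - 1) := by
    rw [h2]; field_simp; ring
  rw [h4] at h
  nlinarith

lemma exists_tail_small {η C : ℝ} (hη : 0 < η) :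
    ∃ X : ℝ, ∀ x, X ≤ x → 1 ≤ x →
      16 * x ^ (2 + 2 * η) * Real.exp (C - x ^ η / 2) ≤ 1 / 2 := by
  have h1 := (tendsto_rpow_mul_exp_neg_mul_atTop_nhds_zero ((2 + 2 * η) / η) (1 / 2)
    (by norm_num)).comp (tendsto_rpow_atTop hη)
  have h2 := h1.eventually (gt_mem_nhds (show 0 < (32 * Real.exp C)⁻¹ by positivity))
  obtain ⟨X, hX⟩ := eventually_atTop.1 h2
  refine ⟨X, fun x hx hx1 => ?_⟩
  have h3 := hX x hx
  simp only [Function.comp_apply] at h3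
  rw [← Real.rpow_mul (by linarith), mul_div_cancel₀ _ hη.ne', ← one_div, lt_div_iff₀
    (by positivity)] at h3
  rw [sub_eq_add_neg, Real.exp_add]
  have h4 : -(x ^ η / 2) = -(1 / 2) * x ^ η := by ring
  rw [h4]
  nlinarith

/-- Where the variance of the weights is large, most of it comes from a window of size
`a ^ (1/2 + o(1))`. -/
lemma CovEntire.exists_finite_measure_window (ha : CovEntire a)
    (hinf : {n : ℕ | a n ≠ 0}.Infinite) {ε : ℝ} (hε : 0 < ε) :
    ∃ F : Set ℝ, MeasurableSet F ∧ volume F < ⊤ ∧ ∃ A : ℝ, ∀ t, t ∉ F → A ≤ logMean a t →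
      1 ≤ logVar a t → ∃ s : Finset ℕ, logVar a t ^ 2 ≤ 12 * logMean a t ^ (3 / 2 + ε) *
        ∑ n ∈ s, (((n : ℝ) - logMean a t) * weight a t n) ^ 2 := by
  -- The steps `δ j` are barely summable, and the gaps between the levels `L j` are of order `1 / δ
  -- j`; so `δ` times the variation of the mean stays bounded.
  set η : ℝ := ε / 3 with hη
  have hη0 : 0 < η := by positivity
  set δ : ℕ → ℝ := fun j => ((j + 1 : ℕ) : ℝ) ^ (-(1 + η)) with hδ
  set L : ℕ → ℝ := fun j => ((j + 1 : ℕ) : ℝ) ^ (2 + η) with hL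
  have hδs : Summable δ :=
    (summable_nat_add_iff 1).2 (Real.summable_nat_rpow.2 (by linarith : -(1 + η) < -1))
  have hmono := (ha.strictMono_logMean hinf).monotone
  obtain ⟨F, hFm, hFv, hF⟩ := exists_finite_measure_levels hmono L hδs
  obtain ⟨X, hX⟩ := exists_tail_small (η := η) (C := (2 + η) * 2 ^ (2 + η - 1)) hη0
  refine ⟨F, hFm, hFv, max 1 ((max X 0 + 1) ^ (2 + η)), fun t ht hA hβ => ?_⟩
  have hα1 : 1 ≤ logMean a t := (le_max_left _ _).trans hA
  have hαX : (max X 0 + 1) ^ (2 + η) ≤ logMean a t := (le_max_right _ _).trans hA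
  have hα0 : 0 ≤ logMean a t := by linarith
  have hp : 0 < 2 + η := by linarith
  set y : ℝ := logMean a t ^ (2 + η)⁻¹ with hy
  have hyp : y ^ (2 + η) = logMean a t := Real.rpow_inv_rpow hα0 hp.ne'
  have hy0 : 0 ≤ y := by positivity
  have hy1 : 1 ≤ y := Real.one_le_rpow hα1 (by positivity)
  obtain ⟨j, hj⟩ : ∃ j, ⌊y⌋₊ = j + 1 := ⟨⌊y⌋₊ - 1, by have := Nat.floor_pos.2 hy1; omega⟩
  set x : ℝ := ((j + 1 : ℕ) : ℝ) with hx
  have hx1 : 1 ≤ x := by rw [hx]; exact_mod_cast Nat.le_add_left 1 j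
  have hx0 : 0 < x := by linarith
  have hxy : x ≤ y := by rw [hx, ← hj]; exact Nat.floor_le hy0
  have hyx : y < x + 1 := by rw [hx, ← hj]; exact Nat.lt_floor_add_one y
  have hLj : L j ≤ logMean a t := by
    rw [← hyp]
    exact Real.rpow_le_rpow hx0.le hxy hp.le
  have hL1 : L (j + 1) = (x + 1) ^ (2 + η) := by rw [hL, hx]; push_cast; rfl
  have hLj1 : logMean a t < L (j + 1) := by
    rw [hL1, ← hyp]
    exact Real.rpow_lt_rpow hy0 hyx hp
  have hXx : X ≤ x := by
    have h1 : max X 0 + 1 ≤ y := by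
      rw [← Real.rpow_le_rpow_iff (by positivity) hy0 hp, hyp]
      exact hαX
    have := le_max_left X 0
    linarith
  obtain ⟨hup, hlo⟩ := hF t ht j hLj hLj1
  have hgap : L (j + 1) - L j ≤ (2 + η) * 2 ^ (2 + η - 1) * x ^ (2 + η - 1) := by
    rw [hL1]
    exact rpow_add_one_sub_rpow_le (by linarith) hx1
  have hδj : 0 < δ j := by simp only [hδ]; positivity
  have hδx : δ j * x ^ (2 + η - 1) = 1 := by
    simp only [hδ]
    rw [← Real.rpow_add hx0]
    ring_nf
    exact Real.rpow_zero _
  have hΛ : ∀ d, d ≤ L (j + 1) - L j → δ j * d ≤ (2 + η) * 2 ^ (2 + η - 1) := by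
    intro d hd
    calc δ j * d ≤ δ j * ((2 + η) * 2 ^ (2 + η - 1) * x ^ (2 + η - 1)) := by
          gcongr
          exact hd.trans hgap
      _ = (2 + η) * 2 ^ (2 + η - 1) * (δ j * x ^ (2 + η - 1)) := by ring
      _ = _ := by rw [hδx, mul_one]
  -- Here `δ j * D = x ^ η` makes the tail negligible, while `D³ = x ^ (3 + 6η)` stays below `α ^
  -- (3/2 + ε)` because `x ^ (2 + η) ≤ α` and `ε = 3η`.
  set D : ℝ := x ^ (1 + 2 * η) with hD
  have hD1 : 1 ≤ D := Real.one_le_rpow hx1 (by linarith)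
  have hδD : δ j * D = x ^ η := by
    simp only [hδ, hD]
    rw [← Real.rpow_add hx0]
    ring_nf
  have hδ2 : 16 / δ j ^ 2 = 16 * x ^ (2 + 2 * η) := by
    have h : δ j ^ 2 = x ^ (-(2 + 2 * η)) := by
      simp only [hδ]
      rw [← Real.rpow_natCast, ← Real.rpow_mul hx0.le]
      congr 1
      push_cast
      ring
    rw [h, Real.rpow_neg hx0.le, div_inv_eq_mul]
  have hmain := ha.sq_logVar_le hinf hδj (by linarith : 0 ≤ D)
    (hΛ _ (by linarith)) (hΛ _ (by linarith))
    (by rw [hδ2, hδD]; exact (hX x hXx hx1).trans (by linarith))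
  refine ⟨_, hmain.trans (mul_le_mul_of_nonneg_right ?_ (Finset.sum_nonneg fun n _ => sq_nonneg _))⟩
  have hD3 : D ^ 3 ≤ logMean a t ^ (3 / 2 + ε) := by
    calc D ^ 3 = x ^ (3 + 6 * η) := by
          rw [hD, ← Real.rpow_natCast, ← Real.rpow_mul hx0.le]
          congr 1
          push_cast
          ring
      _ ≤ x ^ ((2 + η) * (3 / 2 + ε)) := by
          refine Real.rpow_le_rpow_of_exponent_le hx1 ?_
          rw [hη]
          nlinarith
      _ = (x ^ (2 + η)) ^ (3 / 2 + ε) := Real.rpow_mul hx0.le _ _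
      _ ≤ _ := Real.rpow_le_rpow (by positivity) hLj (by linarith)
  nlinarith [mul_nonneg (sub_nonneg.2 hD1) (sq_nonneg D)]

/-- If the variance of the weights is monotone, most of it comes from a window of size comparable to
the standard deviation. -/
lemma CovEntire.exists_finite_measure_window_of_monotone (ha : CovEntire a)
    (hinf : {n : ℕ | a n ≠ 0}.Infinite) (hmono : Monotone (logVar a)) :
    ∃ F : Set ℝ, MeasurableSet F ∧ volume F < ⊤ ∧ ∃ C : ℝ, 0 < C ∧ ∀ t, t ∉ F → 0 ≤ t →
      ∃ s : Finset ℕ, Real.sqrt (logVar a t) ≤ C *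
        ∑ n ∈ s, (((n : ℝ) - logMean a t) * weight a t n) ^ 2 := by
  have hb0 := ha.logVar_pos hinf 0
  set b₀ : ℝ := logVar a 0 with hb
  -- The levels are now dyadic values of the variance, with steps `δ j = L j ^ (-1/2)` summable as a
  -- geometric series. Off `F` the variance less than doubles past `L j` in time `δ j`, so the mean
  -- varies by at most `2 / δ j` on each side.
  set L : ℕ → ℝ := fun j => 2 ^ j * b₀ with hL
  have hLpos : ∀ j, 0 < L j := fun j => by simp only [hL]; positivity
  set δ : ℕ → ℝ := fun j => (Real.sqrt (L j))⁻¹ with hδ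
  have hδpos : ∀ j, 0 < δ j := fun j => inv_pos.2 (Real.sqrt_pos.2 (hLpos j))
  have hδs : Summable δ := by
    have h : δ = fun j => (Real.sqrt b₀)⁻¹ * ((Real.sqrt 2)⁻¹) ^ j := by
      funext j
      simp only [hδ, hL]
      rw [Real.sqrt_mul (by positivity), mul_inv, mul_comm, inv_pow]
      congr 2
      rw [Real.sqrt_eq_iff_mul_self_eq (by positivity) (by positivity), ← mul_pow,
        Real.mul_self_sqrt zero_le_two]
    rw [h]
    refine (summable_geometric_of_lt_one (by positivity) ?_).mul_left _
    exact inv_lt_one_of_one_lt₀ (Real.lt_sqrt_of_sq_lt (by norm_num))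
  obtain ⟨F, hFm, hFv, hF⟩ := exists_finite_measure_levels hmono L hδs
  refine ⟨F, hFm, hFv, 576 * (24 + (Real.sqrt b₀)⁻¹), by positivity, fun t ht ht0 => ?_⟩
  have hβ := ha.logVar_pos hinf t
  have hβ0 : b₀ ≤ logVar a t := hmono ht0
  obtain ⟨j, hj1, hj2⟩ := exists_nat_pow_near (x := logVar a t / b₀) (y := 2)
    ((one_le_div hb0).2 hβ0) one_lt_two
  rw [le_div_iff₀ hb0] at hj1
  rw [div_lt_iff₀ hb0] at hj2
  obtain ⟨hup, -⟩ := hF t ht j hj1 hj2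
  have hLj1 : L (j + 1) = 2 * L j := by simp only [hL]; ring
  have hδL : δ j ^ 2 * L j = 1 := by
    simp only [hδ]
    rw [inv_pow, Real.sq_sqrt (hLpos j).le, inv_mul_cancel₀ (hLpos j).ne']
  have hmv : ∀ s u, s ≤ u → logMean a u - logMean a s ≤ logVar a u * (u - s) := by
    intro s u hsu
    refine (convex_Icc s u).image_sub_le_mul_sub_of_deriv_le
      (ha.continuous_logMean hinf.nonempty).continuousOn
      (fun y _ => (ha.hasDerivAt_logMean
        hinf.nonempty y).differentiableAt.differentiableWithinAt)
      (fun y hy => ?_) s (Set.left_mem_Icc.2 hsu) u (Set.right_mem_Icc.2 hsu) hsu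
    rw [(ha.hasDerivAt_logMean hinf.nonempty y).deriv]
    exact hmono (interior_subset hy).2
  have hδj := hδpos j
  have h1 : δ j * (logMean a (t + δ j) - logMean a t) ≤ 2 := by
    have := hmv t (t + δ j) (by linarith)
    have h2 : logVar a (t + δ j) ≤ 2 * L j := by linarith
    calc _ ≤ δ j * ((2 * L j) * (t + δ j - t)) := by
          gcongr
          refine this.trans ?_
          gcongr
          linarith
      _ = 2 * (δ j ^ 2 * L j) := by ring
      _ = 2 := by rw [hδL, mul_one]
  have h2 : δ j * (logMean a t - logMean a (t - δ j)) ≤ 2 := by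
    have := hmv (t - δ j) t (by linarith)
    have h2 : logVar a t ≤ 2 * L j := by
      rw [← hLj1]
      exact hj2.le
    calc _ ≤ δ j * ((2 * L j) * (t - (t - δ j))) := by
          gcongr
          refine this.trans ?_
          gcongr
          linarith
      _ = 2 * (δ j ^ 2 * L j) := by ring
      _ = 2 := by rw [hδL, mul_one]
  set q : ℝ := Real.sqrt (L j) with hq
  have hq0 : 0 < q := Real.sqrt_pos.2 (hLpos j)
  have hqL : q ^ 2 = L j := Real.sq_sqrt (hLpos j).le
  have hδq : δ j = q⁻¹ := rfl
  -- The half-width `12 q` makes the exponent `2 - 6 = -4`; then the tail `16 L j exp (-4)` is at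
  -- most `L j / 2`.
  have hexp : Real.exp (2 - δ j * (12 * q) / 2) ≤ 1 / 32 := by
    have h3 : 2 - δ j * (12 * q) / 2 = -((4 : ℕ) * 1 : ℝ) := by
      rw [hδq]
      field_simp
      norm_num
    rw [h3, Real.exp_neg, Real.exp_nat_mul, one_div]
    refine inv_anti₀ (by norm_num) ?_
    have h4 := pow_le_pow_left₀ (by norm_num) Real.exp_one_gt_d9.le 4
    refine le_trans (by norm_num) h4
  have hmain := ha.sq_logVar_le hinf hδj (by positivity : 0 ≤ 12 * q) h1 h2 (by
    have h3 : 16 / δ j ^ 2 = 16 * L j := by rw [hδq, ← hqL]; field_simp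
    rw [h3]
    have : L j ≤ logVar a t := hj1
    nlinarith [hLpos j])
  refine ⟨window a t (12 * q), ?_⟩
  set S := ∑ n ∈ window a t (12 * q), (((n : ℝ) - logMean a t) * weight a t n) ^ 2 with hS
  have hS0 : 0 ≤ S := Finset.sum_nonneg fun n _ => sq_nonneg _
  set w : ℝ := Real.sqrt (logVar a t) with hw
  have hw0 : 0 < w := Real.sqrt_pos.2 hβ
  have hw2 : w ^ 2 = logVar a t := Real.sq_sqrt hβ.le
  have hqw : q ≤ w := Real.sqrt_le_sqrt hj1
  have hbw : 1 ≤ (Real.sqrt b₀)⁻¹ * w := by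
    rw [← div_eq_inv_mul, one_le_div (Real.sqrt_pos.2 hb0)]
    exact Real.sqrt_le_sqrt hβ0
  rw [← hw2] at hmain
  have h5 : (2 * (12 * q) + 1) * (12 * q) ^ 2 ≤ ((24 + (Real.sqrt b₀)⁻¹) * w) * (144 * w ^ 2) := by
    refine mul_le_mul ?_ ?_ (by positivity) (by positivity)
    · linarith
    · rw [mul_pow]
      gcongr
      norm_num
  have h6 : (w ^ 2) ^ 2 ≤ 4 * (((24 + (Real.sqrt b₀)⁻¹) * w) * (144 * w ^ 2)) * S :=
    hmain.trans (by gcongr)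
  have h7 : w * w ^ 3 ≤ (576 * (24 + (Real.sqrt b₀)⁻¹) * S) * w ^ 3 := by
    calc w * w ^ 3 = (w ^ 2) ^ 2 := by ring
      _ ≤ _ := h6
      _ = _ := by ring
  exact le_of_mul_le_mul_right h7 (by positivity)

end ExceptionalSets

/-! ### Assembly of the two lower bounds. -/

section Main

variable {Ω : Type*} [MeasurableSpace Ω] {P : Measure Ω} [IsProbabilityMeasure P] {a : ℕ → ℝ}
  {ξ : ℕ → Ω → ℂ}

lemma IsIIDStdComplexGaussian.lesssimL_variance (hξ : IsIIDStdComplexGaussian P ξ)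
    (ha0 : ∀ n, 0 ≤ a n) (ha : CovEntire a) (hinf : {n : ℕ | a n ≠ 0}.Infinite) {ε : ℝ}
    (hε : 0 < ε) :
    LesssimL (fun r => bFun a (r ^ 2) ^ 2 / aFun a (r ^ 2) ^ ((3 : ℝ) / 2 + ε))
      (fun r => variance (gafZeroCount a ξ r) P) := by
  have hne := hinf.nonempty
  obtain ⟨F₁, hm₁, hv₁, A, hF₁⟩ := ha.exists_finite_measure_window hinf hε
  obtain ⟨F₂, hm₂, hv₂, hF₂⟩ := ha.exists_finite_measure_fract hinf
  obtain ⟨T, hT⟩ := Filter.eventually_atTop.1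
    ((ha.tendsto_logMean hinf).eventually_ge_atTop (max A 1))
  -- The constant is `12 · 4/3`. The added interval `[0, T]` removes the times at which the mean may
  -- still be below `max A 1`.
  refine ⟨16, by norm_num, _, finiteLogMeasure_of_volume
    ((hm₁.union hm₂).union (measurableSet_Icc (a := (0 : ℝ)) (b := T))) ?_, fun r hr hrE => ?_⟩
  · refine (measure_union_le _ _).trans_lt (ENNReal.add_lt_top.2 ⟨?_, measure_Icc_lt_top⟩)
    exact (measure_union_le _ _).trans_lt (ENNReal.add_lt_top.2 ⟨hv₁, hv₂⟩)
  have hr0 : 0 < r := by linarith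
  set t := 2 * Real.log r with ht
  have ht0 : 0 ≤ t := by have := Real.log_nonneg hr; positivity
  simp only [Set.mem_ofPred_eq, hr0, true_and, Set.mem_union, not_or, Set.mem_Icc, not_and,
    not_le] at hrE
  obtain ⟨⟨h1, h2⟩, h3⟩ := hrE
  have hA := hT t (h3 ht0).le
  have hA0 : A ≤ logMean a t := (le_max_left _ _).trans hA
  have hA1 : 1 ≤ logMean a t := (le_max_right _ _).trans hA
  have hpos : 0 < logMean a t ^ ((3 : ℝ) / 2 + ε) := by positivity
  have hV := variance_nonneg (gafZeroCount a ξ r) P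
  simp only [sq_eq_exp_two_mul_log hr0]
  change logVar a t ^ 2 / logMean a t ^ ((3 : ℝ) / 2 + ε) ≤ _
  rw [div_le_iff₀ hpos]
  rcases le_total 1 (logVar a t) with hb | hb
  · obtain ⟨s, hs⟩ := hF₁ t h1 hA0 hb
    have hS := hξ.sum_sq_le_variance ha0 ha hne hr0 s
    calc _ ≤ _ := hs
      _ ≤ 12 * logMean a t ^ (3 / 2 + ε) * (4 / 3 * variance (gafZeroCount a ξ r) P) := by
        gcongr
      _ = _ := by ring
  · have hS := hξ.fract_le_variance ha0 ha hne hr0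
    rw [sq_eq_exp_two_mul_log hr0] at hS
    change fractProd (logMean a t) ≤ _ at hS
    have he : logMean a t ^ (3 / 2 : ℝ) ≤ logMean a t ^ ((3 : ℝ) / 2 + ε) :=
      Real.rpow_le_rpow_of_exponent_le hA1 (by linarith)
    calc _ ≤ _ := hF₂ t h2 hA1 hb
      _ ≤ logMean a t ^ ((3 : ℝ) / 2 + ε) * variance (gafZeroCount a ξ r) P := by
        gcongr
        exact fractProd_nonneg _
      _ ≤ _ := by nlinarith [mul_nonneg hpos.le hV]

lemma IsIIDStdComplexGaussian.lesssimL_variance_of_monotoneOn (hξ : IsIIDStdComplexGaussian P ξ)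
    (ha0 : ∀ n, 0 ≤ a n) (ha : CovEntire a) (hinf : {n : ℕ | a n ≠ 0}.Infinite)
    (hb : MonotoneOn (bFun a) (Set.Ioi 0)) :
    LesssimL (fun r => Real.sqrt (bFun a (r ^ 2)))
      (fun r => variance (gafZeroCount a ξ r) P) := by
  have hmono : Monotone (logVar a) := fun s t hst =>
    hb (Real.exp_pos s) (Real.exp_pos t) (Real.exp_le_exp.2 hst)
  obtain ⟨F, hm, hv, C, hC, hF⟩ := ha.exists_finite_measure_window_of_monotone hinf hmono
  refine ⟨C * (4 / 3), by positivity, _, finiteLogMeasure_of_volume hm hv, fun r hr hrE => ?_⟩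
  have hr0 : 0 < r := by linarith
  have hrF : 2 * Real.log r ∉ F := fun h => hrE ⟨hr0, h⟩
  obtain ⟨s, hs⟩ := hF _ hrF (by have := Real.log_nonneg hr; positivity)
  have hS := hξ.sum_sq_le_variance ha0 ha hinf.nonempty hr0 s
  simp only [sq_eq_exp_two_mul_log hr0]
  calc _ ≤ _ := hs
    _ ≤ C * (4 / 3 * variance (gafZeroCount a ξ r) P) := by gcongr
    _ = _ := by ring

end Main

end GaussianEntire

theorem theorem1 {Ω : Type*} [MeasurableSpace Ω] (P : Measure Ω) [IsProbabilityMeasure P]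
    (a : ℕ → ℝ) (ha_nonneg : ∀ n, 0 ≤ a n)
    (ha_transcendental : {n : ℕ | a n ≠ 0}.Infinite)
    (ha_entire : GaussianEntire.CovEntire a)
    (ξ : ℕ → Ω → ℂ) (hξ : GaussianEntire.IsIIDStdComplexGaussian P ξ) :
    (∀ r : ℝ, 0 < r → MemLp (GaussianEntire.gafZeroCount a ξ r) 2 P) ∧
    (∀ ε : ℝ, 0 < ε →
      GaussianEntire.LesssimL
        (fun r => GaussianEntire.bFun a (r ^ 2) ^ 2 /
          GaussianEntire.aFun a (r ^ 2) ^ ((3 : ℝ) / 2 + ε))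
        (fun r => variance (GaussianEntire.gafZeroCount a ξ r) P)) ∧
    (MonotoneOn (GaussianEntire.bFun a) (Set.Ioi 0) →
      GaussianEntire.LesssimL
        (fun r => Real.sqrt (GaussianEntire.bFun a (r ^ 2)))
        (fun r => variance (GaussianEntire.gafZeroCount a ξ r) P)) := by
  have hne := ha_transcendental.nonempty
  exact ⟨fun r hr => hξ.memLp_gafZeroCount ha_nonneg ha_entire hne hr,
    fun ε hε => hξ.lesssimL_variance ha_nonneg ha_entire ha_transcendental hε,
    hξ.lesssimL_variance_of_monotoneOn ha_nonneg ha_entire ha_transcendental⟩
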